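/- Let $k \ge 1$ be an integer and let $G$ be a finite simple non-bipartite graph. Let $A$ be the adjacency matrix of $G$ and let $\lambda_1$ be the largest eigenvalue of $A$. If $G$ contains none of the odd cycles $C_3, C_5, \ldots, C_{2k+1}$ as a (not necessarily induced) subgraph, then $$\lambda_1^{2k} \le \frac{\operatorname{Tr}(A^{2k})}{2} - \left(2\cos\frac{\pi}{k+2}\right)^{2k}.$$ Moreover, equality holds if and only if $k = 1$ and $G$ is isomorphic to the disjoint union of the $5$-cycle $C_5$ and a (possibly empty) set of isolated vertices. -/

import Mathlib

/-- The largest eigenvalue `λ₁(G)` of the adjacency matrix of a finite simple graph `G`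
(the maximum over the finite family of eigenvalues of the real symmetric matrix `A(G)`). -/
noncomputable def SimpleGraph.lambdaOne {V : Type*} [Fintype V] [DecidableEq V]
    (G : SimpleGraph V) [DecidableRel G.Adj] : ℝ :=
  ⨆ i : V, (G.isHermitian_adjMatrix ℝ).eigenvalues i

/-- On a nonempty vertex set, `λ₁(G)` is the greatest element of the spectrum of `A(G)`. -/
theorem SimpleGraph.isGreatest_lambdaOne {V : Type*} [Fintype V] [DecidableEq V] [Nonempty V]
    (G : SimpleGraph V) [DecidableRel G.Adj] :
    IsGreatest (spectrum ℝ (G.adjMatrix ℝ)) G.lambdaOne := by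
  rw [(G.isHermitian_adjMatrix ℝ).spectrum_real_eq_range_eigenvalues]
  exact ⟨Set.Nonempty.csSup_mem (Set.range_nonempty _) (Set.finite_range _),
    fun _ hx => le_csSup (Set.finite_range _).bddAbove hx⟩

/-- `G` is `{C₃, C₅, …, C_{2k+1}}`-free: it contains none of these odd cycles as a
(not necessarily induced) subgraph. -/
def SimpleGraph.ShortOddCycleFree {V : Type*} (k : ℕ) (G : SimpleGraph V) : Prop :=
  ∀ l : ℕ, 1 ≤ l → l ≤ k → (SimpleGraph.cycleGraph (2 * l + 1)).Free G

/-- `G` is isomorphic to `C₅` together with `m ≥ 0` isolated vertices. -/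
def SimpleGraph.IsC5WithIsolated {V : Type*} (G : SimpleGraph V) : Prop :=
  ∃ m : ℕ, Nonempty (G ≃g (SimpleGraph.cycleGraph 5 ⊕g (⊥ : SimpleGraph (Fin m))))

/-!
The proof treats `k ≥ 2`, where the inequality is strict, and `k = 1` separately.

Suppose `k ≥ 2`, put `c = 2 cos (π / (k + 2))`, and let `μ` be the family of eigenvalues of the
adjacency matrix `A`. There are no closed walks of length `2k + 1`, so `∑ μ i ^ (2k + 1) = 0`, and
`|μ i| ≤ λ₁` for every `i`. If besides `λ₁` there are two more positive eigenvalues, one of which is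
at least `c`, then a majorization argument shows that the negative eigenvalues contribute at least
`λ₁ ^ (2k) + c ^ (2k)` to `Tr A ^ (2k)`, and the positive ones contribute more than that
(`two_mul_pow_add_pow_lt_sum_pow`). The two eigenvalues come from the min-max principle, applied to
a shortest odd cycle, whose length `s` is at least `2k + 3`. An induced path on six vertices in it
gives a third positive eigenvalue. For the second one, `c` is the largest eigenvalue of the path on
`k + 1` vertices, so two such paths that are disjoint and not joined by an edge suffice. They exist
inside the cycle if `s ≥ 2k + 5`, and with the help of a vertex adjacent to the cycle if
`s = 2k + 3`. There remains the case that the cycle is a component of length `2k + 3`. It has the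
eigenvalue `2 > c`, so the argument applies if `λ₁ > 2`. If `λ₁ = 2`, counting the closed walks
inside the cycle gives `Tr A ^ (2k) ≥ (2k + 3) * centralBinom k`, and this is large enough
(`two_mul_cos_pow_lt_mul_centralBinom`).

For `k = 1` the claim is that `λ₁ ^ 2` is at most the number of edges minus one. The row sum of
`A ^ 2` at `w` counts the edges meeting the neighbourhood `N(w)`, which is independent, so it is at
most the number of edges, and at least one edge is missed because `G` is not bipartite
(`two_mul_row_sum_add_card_missedDarts`). Evaluating `A ^ 2 v = λ₁ ^ 2 v` where `|v|` is largest
gives the inequality. In the case of equality exactly one edge `yz` is missed at every such vertex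
`w`; as moving `y` or `z` to the side of `N(w)` does not give a bipartition, `w`, `y`, `z` lie on a
pentagon, and the same property of all vertices of the pentagon excludes further edges
(`isC5WithIsolated_of_closed`).
-/

/-! ### Power sums of real sequences -/

theorem weighted_amgm_pow {x y : ℝ} (hx : 0 ≤ x) (hy : 0 ≤ y) (q : ℕ) :
    (q + 1) * x * y ^ q ≤ x ^ (q + 1) + q * y ^ (q + 1) := by
  induction q with
  | zero => simp
  | succ q ih =>
    have h1 := mul_le_mul_of_nonneg_left ih hx
    have h2 : 0 ≤ (q + 1) * y ^ q * (x - y) ^ 2 := by positivity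
    push_cast
    ring_nf at h1 h2 ⊢
    linarith

/-- The case of two numbers `z, g ∈ [b, a]` in `pow_add_pow_le_sum_pow`. -/
theorem pow_add_pow_le_pow_add_pow {a b z g : ℝ} {q : ℕ} (hb : 0 < b) (hbg : b ≤ g)
    (hgz : g ≤ z) (hza : z ≤ a)
    (h : a ^ (q + 1) + b ^ (q + 1) ≤ z ^ (q + 1) + g ^ (q + 1)) :
    a ^ q + b ^ q ≤ z ^ q + g ^ q := by
  have hg : 0 < g := hb.trans_le hbg
  have hz : 0 < z := hg.trans_le hgz
  have ha : 0 < a := hz.trans_le hza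
  have h1 := weighted_amgm_pow hg.le hb.le q
  have h2 := weighted_amgm_pow hz.le ha.le q
  have h3 : z ^ q ≤ a ^ q := pow_le_pow_left₀ hz.le hza q
  have h4 : (q + 1) * g * (a ^ q - z ^ q) ≤ (q + 1) * z * (a ^ q - z ^ q) := by
    have : 0 ≤ a ^ q - z ^ q := by linarith
    gcongr
  have h5 : (q + 1) * g * (a ^ q - z ^ q) ≤ (q + 1) * g * (g ^ q - b ^ q) := by
    have h6 : (q : ℝ) * (a ^ (q + 1) + b ^ (q + 1)) ≤ q * (z ^ (q + 1) + g ^ (q + 1)) := by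
      gcongr
    ring_nf at h1 h2 h4 h6 ⊢
    linarith
  have h6 := le_of_mul_le_mul_left h5 (by positivity)
  linarith

/-- A majorization inequality: if numbers `z i ∈ [0, a]` have at least the `(q+1)`-st power sum of
the pair `a ≥ b`, they also have at least its `q`-th power sum. -/
theorem pow_add_pow_le_sum_pow {ι : Type*} (s : Finset ι) (z : ι → ℝ) {a b : ℝ} {q : ℕ}
    (hq : q ≠ 0) (hb : 0 < b) (hba : b ≤ a) (hz0 : ∀ i ∈ s, 0 ≤ z i) (hza : ∀ i ∈ s, z i ≤ a)
    (h : a ^ (q + 1) + b ^ (q + 1) ≤ ∑ i ∈ s, z i ^ (q + 1)) :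
    a ^ q + b ^ q ≤ ∑ i ∈ s, z i ^ q := by
  classical
  have ha : 0 < a := hb.trans_le hba
  -- `z ^ (q + 1) ≤ c * z ^ q` for `z ≤ c`, summed over any subset
  have key (t : Finset ι) (c : ℝ) (ht : t ⊆ s) (hc : ∀ i ∈ t, z i ≤ c) :
      ∑ i ∈ t, z i ^ (q + 1) ≤ c * ∑ i ∈ t, z i ^ q := by
    rw [Finset.mul_sum]
    refine Finset.sum_le_sum fun i hi => ?_
    rw [pow_succ, mul_comm]
    exact mul_le_mul_of_nonneg_right (hc i hi) (pow_nonneg (hz0 i (ht hi)) q)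
  by_cases hcase : ∀ i ∈ s, z i ≤ b
  · have h1 := key s b subset_rfl hcase
    have h2 : b * (a ^ q + b ^ q) ≤ b * ∑ i ∈ s, z i ^ q := by
      refine le_trans ?_ (h.trans h1)
      have : b * a ^ q ≤ a * a ^ q := by gcongr
      rw [pow_succ, pow_succ]
      linarith
    exact le_of_mul_le_mul_left h2 hb
  push Not at hcase
  obtain ⟨i₀, hi₀, hbi⟩ := hcase
  -- the numbers other than `z i₀` are replaced by the single number `g` with the same
  -- `(q+1)`-st power sum, which does not increase the `q`-th power sum
  set X := ∑ i ∈ s.erase i₀, z i ^ (q + 1) with hX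
  have hX0 : 0 ≤ X :=
    Finset.sum_nonneg fun i hi => pow_nonneg (hz0 i (Finset.mem_of_mem_erase hi)) _
  obtain ⟨g, hg0, hg⟩ : ∃ g : ℝ, 0 ≤ g ∧ g ^ (q + 1) = X :=
    ⟨X ^ (((q + 1 : ℕ) : ℝ)⁻¹), by positivity, Real.rpow_inv_natCast_pow hX0 (by simp)⟩
  have hle : ∀ i ∈ s.erase i₀, z i ≤ g := by
    intro i hi
    have : z i ^ (q + 1) ≤ g ^ (q + 1) := by
      rw [hg]
      exact Finset.single_le_sum (f := fun i => z i ^ (q + 1))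
        (fun j hj => pow_nonneg (hz0 j (Finset.mem_of_mem_erase hj)) _) hi
    exact le_of_pow_le_pow_left₀ (by simp) hg0 this
  rw [← Finset.add_sum_erase s _ hi₀] at h ⊢
  rw [← hX, ← hg] at h
  have hsum : g ^ q ≤ ∑ i ∈ s.erase i₀, z i ^ q := by
    rcases hg0.eq_or_lt with h0 | h0
    · rw [← h0, zero_pow hq]
      exact Finset.sum_nonneg fun i hi => pow_nonneg (hz0 i (Finset.mem_of_mem_erase hi)) _
    · have := key (s.erase i₀) g (Finset.erase_subset _ _) hle
      rw [← hX, ← hg, pow_succ, mul_comm] at this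
      exact le_of_mul_le_mul_left this h0
  have hz₀ := hza i₀ hi₀
  have hbg : b ≤ g := by
    have h1 : z i₀ ^ (q + 1) ≤ a ^ (q + 1) := pow_le_pow_left₀ (hz0 i₀ hi₀) hz₀ _
    exact le_of_pow_le_pow_left₀ (n := q + 1) (by simp) hg0 (by linarith)
  have hfin : a ^ q + b ^ q ≤ z i₀ ^ q + g ^ q := by
    rcases le_total g (z i₀) with h1 | h1
    · exact pow_add_pow_le_pow_add_pow hb hbg h1 hz₀ h
    rcases le_total g a with h2 | h2
    · have := pow_add_pow_le_pow_add_pow hb hbi.le h1 h2 (q := q) (by linarith)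
      linarith
    · have h3 : a ^ q ≤ g ^ q := pow_le_pow_left₀ ha.le h2 q
      have h4 : b ^ q ≤ z i₀ ^ q := pow_le_pow_left₀ hb.le hbi.le q
      linarith
  linarith

/-- If a family with vanishing odd power sum has its largest absolute value `μ i₁` attained at a
positive member, and has two further members `μ i₂ ≥ c > 0` and `μ i₃ > 0`, then its even power sum
exceeds `2 (μ i₁ ^ q + c ^ q)`: the positive members contribute more than half of this, and the
negative members at least half of it by `pow_add_pow_le_sum_pow`. -/
theorem two_mul_pow_add_pow_lt_sum_pow {ι : Type*} [Fintype ι] (μ : ι → ℝ) {q : ℕ} (hq : q ≠ 0)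
    (hqe : Even q) {c : ℝ} (hc : 0 < c) {i₁ i₂ i₃ : ι} (h12 : i₂ ≠ i₁) (h13 : i₃ ≠ i₁)
    (h23 : i₃ ≠ i₂) (habs : ∀ i, |μ i| ≤ μ i₁) (h2 : c ≤ μ i₂) (h3 : 0 < μ i₃)
    (hodd : ∑ i, μ i ^ (q + 1) = 0) :
    2 * (μ i₁ ^ q + c ^ q) < ∑ i, μ i ^ q := by
  classical
  have h1 : 0 < μ i₁ := hc.trans_le (h2.trans ((le_abs_self _).trans (habs i₂)))
  set P := Finset.univ.filter fun i => 0 ≤ μ i with hP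
  set N := Finset.univ.filter fun i => ¬ 0 ≤ μ i with hN
  have hsub : ({i₁, i₂, i₃} : Finset ι) ⊆ P := by
    intro i hi
    simp only [Finset.mem_insert, Finset.mem_singleton] at hi
    simp only [hP, Finset.mem_filter, Finset.mem_univ, true_and]
    rcases hi with rfl | rfl | rfl
    exacts [h1.le, hc.le.trans h2, h3.le]
  have hpos (n : ℕ) : μ i₁ ^ n + μ i₂ ^ n + μ i₃ ^ n ≤ ∑ i ∈ P, μ i ^ n := by
    have := Finset.sum_le_sum_of_subset_of_nonneg (f := fun i => μ i ^ n) hsub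
      (fun i hi _ => pow_nonneg (Finset.mem_filter.1 hi).2 n)
    rwa [Finset.sum_insert (by simp [h12.symm, h13.symm]), Finset.sum_insert (by simp [h23.symm]),
      Finset.sum_singleton, ← add_assoc] at this
  have hsplit (n : ℕ) : ∑ i ∈ P, μ i ^ n + ∑ i ∈ N, μ i ^ n = ∑ i, μ i ^ n :=
    Finset.sum_filter_add_sum_filter_not _ _ _
  have hNodd : ∑ i ∈ N, (-μ i) ^ (q + 1) = - ∑ i ∈ N, μ i ^ (q + 1) := by
    rw [← Finset.sum_neg_distrib]
    exact Finset.sum_congr rfl fun i _ => hqe.add_one.neg_pow _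
  have hNeven : ∑ i ∈ N, (-μ i) ^ q = ∑ i ∈ N, μ i ^ q :=
    Finset.sum_congr rfl fun i _ => hqe.neg_pow _
  have hneg := pow_add_pow_le_sum_pow N (fun i => -μ i) (a := μ i₁) (b := μ i₂) hq
    (hc.trans_le h2) ((le_abs_self _).trans (habs i₂))
    (fun i hi => by have := (Finset.mem_filter.1 hi).2; linarith)
    (fun i _ => (neg_le_abs _).trans (habs i))
    (by
      have := hpos (q + 1)
      have := hsplit (q + 1)
      have := pow_pos h3 (q + 1)
      rw [hNodd]
      linarith)
  rw [hNeven] at hneg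
  have := hpos q
  have := hsplit q
  have := pow_pos h3 q
  have : c ^ q ≤ μ i₂ ^ q := pow_le_pow_left₀ hc.le h2 q
  linarith

/-! ### Spectral decomposition and the min-max principle -/

section Spectral

variable {V : Type*} [Fintype V] [DecidableEq V] {A : Matrix V V ℝ}

open Matrix

/-- The coordinates of `z` in the orthonormal eigenbasis of a real symmetric matrix. -/
noncomputable def Matrix.IsHermitian.coord (hA : A.IsHermitian) (z : V → ℝ) : V → ℝ :=
  (hA.eigenvectorUnitary : Matrix V V ℝ)ᵀ *ᵥ z

theorem Matrix.IsHermitian.eq_mul_diagonal_mul_transpose (hA : A.IsHermitian) :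
    A = (hA.eigenvectorUnitary : Matrix V V ℝ) * diagonal hA.eigenvalues *
      (hA.eigenvectorUnitary : Matrix V V ℝ)ᵀ := by
  have h := hA.spectral_theorem
  rw [Unitary.conjStarAlgAut_apply] at h
  simpa [star_eq_conjTranspose, Function.comp_def] using h

theorem Matrix.IsHermitian.eigenvectorUnitary_mul_transpose (hA : A.IsHermitian) :
    (hA.eigenvectorUnitary : Matrix V V ℝ) * (hA.eigenvectorUnitary : Matrix V V ℝ)ᵀ = 1 := by
  have h := Unitary.coe_mul_star_self hA.eigenvectorUnitary
  simpa [star_eq_conjTranspose] using h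

theorem Matrix.IsHermitian.transpose_mul_eigenvectorUnitary (hA : A.IsHermitian) :
    (hA.eigenvectorUnitary : Matrix V V ℝ)ᵀ * (hA.eigenvectorUnitary : Matrix V V ℝ) = 1 := by
  have h := Unitary.coe_star_mul_self hA.eigenvectorUnitary
  simpa [star_eq_conjTranspose] using h

theorem Matrix.IsHermitian.dotProduct_self_eq_sum (hA : A.IsHermitian) (z : V → ℝ) :
    z ⬝ᵥ z = ∑ i, hA.coord z i ^ 2 := by
  have h : hA.coord z ⬝ᵥ hA.coord z = z ⬝ᵥ z := by
    unfold coord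
    rw [dotProduct_mulVec, vecMul_transpose, mulVec_mulVec, hA.eigenvectorUnitary_mul_transpose,
      one_mulVec]
  rw [← h]
  simp [dotProduct, sq]

theorem Matrix.IsHermitian.dotProduct_mulVec_eq_sum (hA : A.IsHermitian) (z : V → ℝ) :
    z ⬝ᵥ A *ᵥ z = ∑ i, hA.eigenvalues i * hA.coord z i ^ 2 := by
  have h : hA.coord z ⬝ᵥ diagonal hA.eigenvalues *ᵥ hA.coord z = z ⬝ᵥ A *ᵥ z := by
    unfold coord
    conv_rhs => rw [hA.eq_mul_diagonal_mul_transpose]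
    rw [← mulVec_mulVec, ← mulVec_mulVec, dotProduct_mulVec z, ← mulVec_transpose]
  rw [← h]
  simp only [dotProduct, mulVec_diagonal]
  exact Finset.sum_congr rfl fun i _ => by ring

theorem Matrix.IsHermitian.trace_pow_eq_sum (hA : A.IsHermitian) (n : ℕ) :
    (A ^ n).trace = ∑ i, hA.eigenvalues i ^ n := by
  have h : A ^ n = (hA.eigenvectorUnitary : Matrix V V ℝ) * diagonal (hA.eigenvalues ^ n) *
      (hA.eigenvectorUnitary : Matrix V V ℝ)ᵀ := by
    induction n with
    | zero => simp [hA.eigenvectorUnitary_mul_transpose]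
    | succ n ih =>
      rw [pow_succ, ih]
      conv_lhs => enter [2]; rw [hA.eq_mul_diagonal_mul_transpose]
      rw [show ∀ U D E : Matrix V V ℝ, U * D * Uᵀ * (U * E * Uᵀ) = U * (D * (Uᵀ * U) * E) * Uᵀ by
        intros; simp only [Matrix.mul_assoc], hA.transpose_mul_eigenvectorUnitary, Matrix.mul_one,
        diagonal_mul_diagonal]
      congr 3
  rw [h, Matrix.trace_mul_cycle, hA.transpose_mul_eigenvectorUnitary, Matrix.one_mul,
    trace_diagonal]
  rfl

theorem Matrix.IsHermitian.coord_mulVec (hA : A.IsHermitian) (z : V → ℝ) (i : V) :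
    hA.coord (A *ᵥ z) i = hA.eigenvalues i * hA.coord z i := by
  have h := congrArg ((hA.eigenvectorUnitary : Matrix V V ℝ)ᵀ * ·) hA.eq_mul_diagonal_mul_transpose
  rw [Matrix.mul_assoc, ← Matrix.mul_assoc, hA.transpose_mul_eigenvectorUnitary,
    Matrix.one_mul] at h
  unfold coord
  rw [mulVec_mulVec, h, ← mulVec_mulVec, mulVec_diagonal]

theorem Matrix.IsHermitian.exists_coord_ne_zero (hA : A.IsHermitian) {z : V → ℝ} (hz : z ≠ 0) :
    ∃ i, hA.coord z i ≠ 0 := by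
  by_contra! h
  have := hA.dotProduct_self_eq_sum z
  simp only [h, ne_eq, OfNat.ofNat_ne_zero, not_false_eq_true, zero_pow, Finset.sum_const_zero,
    dotProduct_self_eq_zero] at this
  exact hz this

/-- A family of more than `#S` vectors has a nontrivial combination orthogonal to the eigenvectors
indexed by `S`. -/
theorem Matrix.IsHermitian.exists_coord_eq_zero_on (hA : A.IsHermitian) (S : Finset V) {m : ℕ}
    (hS : S.card < m) (f : Fin m → V → ℝ) :
    ∃ a : Fin m → ℝ, a ≠ 0 ∧ ∀ i ∈ S, hA.coord (∑ j, a j • f j) i = 0 := by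
  let T : (Fin m → ℝ) →ₗ[ℝ] (S → ℝ) :=
    (LinearMap.funLeft ℝ ℝ ((↑) : S → V)).comp
      ((hA.eigenvectorUnitary : Matrix V V ℝ)ᵀ.mulVecLin.comp (Fintype.linearCombination ℝ f))
  have hker : LinearMap.ker T ≠ ⊥ := LinearMap.ker_ne_bot_of_finrank_lt (by simpa using hS)
  obtain ⟨a, ha, ha0⟩ := (Submodule.ne_bot_iff _).1 hker
  refine ⟨a, ha0, fun i hi => ?_⟩
  exact congrFun (LinearMap.mem_ker.1 ha) ⟨i, hi⟩

/-- Courant–Fischer: if the quadratic form of `A` is at least `c` on the span of two orthogonal,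
`A`-orthogonal vectors, then any index may be removed and there is still an eigenvalue `≥ c`. -/
theorem Matrix.IsHermitian.exists_ne_le_eigenvalues (hA : A.IsHermitian) {c : ℝ} {u w : V → ℝ}
    (hu0 : u ≠ 0) (hw0 : w ≠ 0) (huw : u ⬝ᵥ w = 0) (huAw : u ⬝ᵥ A *ᵥ w = 0)
    (hu : c * (u ⬝ᵥ u) ≤ u ⬝ᵥ A *ᵥ u) (hw : c * (w ⬝ᵥ w) ≤ w ⬝ᵥ A *ᵥ w) (i₁ : V) :
    ∃ i, i ≠ i₁ ∧ c ≤ hA.eigenvalues i := by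
  obtain ⟨a, ha0, ha⟩ := hA.exists_coord_eq_zero_on {i₁} (m := 2) (by simp) ![u, w]
  simp only [Fin.sum_univ_two, Matrix.cons_val_zero, Matrix.cons_val_one,
    Finset.mem_singleton, forall_eq] at ha
  set z := a 0 • u + a 1 • w with hz
  have hwAu : w ⬝ᵥ A *ᵥ u = 0 := by
    have hT : Aᵀ = A := by simpa using hA.eq
    rw [dotProduct_mulVec, ← mulVec_transpose, hT, dotProduct_comm, huAw]
  have hzz : z ⬝ᵥ z = a 0 ^ 2 * (u ⬝ᵥ u) + a 1 ^ 2 * (w ⬝ᵥ w) := by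
    simp only [hz, add_dotProduct, dotProduct_add, smul_dotProduct, dotProduct_smul, smul_eq_mul,
      dotProduct_comm w u, huw]
    ring
  have hzAz : z ⬝ᵥ A *ᵥ z = a 0 ^ 2 * (u ⬝ᵥ A *ᵥ u) + a 1 ^ 2 * (w ⬝ᵥ A *ᵥ w) := by
    simp only [hz, add_dotProduct, dotProduct_add, smul_dotProduct, dotProduct_smul, smul_eq_mul,
      mulVec_add, mulVec_smul, huAw, hwAu]
    ring
  have huu : 0 < u ⬝ᵥ u := by
    have := dotProduct_star_self_pos_iff.2 hu0; simpa using this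
  have hww : 0 < w ⬝ᵥ w := by
    have := dotProduct_star_self_pos_iff.2 hw0; simpa using this
  have hpos : 0 < z ⬝ᵥ z := by
    rw [hzz]
    by_cases h0 : a 0 = 0
    · have h1 : a 1 ≠ 0 := by
        intro h1
        apply ha0
        ext j
        fin_cases j <;> simp [h0, h1]
      positivity
    · positivity
  by_contra! hcon
  have hform : c * (z ⬝ᵥ z) ≤ z ⬝ᵥ A *ᵥ z := by
    rw [hzz, hzAz]
    nlinarith [mul_le_mul_of_nonneg_left hu (sq_nonneg (a 0)),
      mul_le_mul_of_nonneg_left hw (sq_nonneg (a 1))]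
  have hterm : ∀ i, hA.eigenvalues i * hA.coord z i ^ 2 ≤ c * hA.coord z i ^ 2 := by
    intro i
    rcases eq_or_ne i i₁ with rfl | hi
    · simp [ha]
    · exact mul_le_mul_of_nonneg_right (hcon i hi).le (sq_nonneg _)
  obtain ⟨i, hi⟩ := hA.exists_coord_ne_zero (z := z) (by rintro h; simp [h] at hpos)
  have hii : i ≠ i₁ := by rintro rfl; exact hi ha
  have hlt : ∑ i, hA.eigenvalues i * hA.coord z i ^ 2 < ∑ i, c * hA.coord z i ^ 2 :=
    Finset.sum_lt_sum (fun i _ => hterm i) ⟨i, Finset.mem_univ i,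
      mul_lt_mul_of_pos_right (hcon i hii) (by positivity)⟩
  rw [← Finset.mul_sum, ← hA.dotProduct_self_eq_sum, ← hA.dotProduct_mulVec_eq_sum] at hlt
  linarith

/-- If the quadratic form of `A` is positive definite on the span of more than `#S` vectors, then
`A` has a positive eigenvalue with index outside `S`. -/
theorem Matrix.IsHermitian.exists_notMem_eigenvalues_pos (hA : A.IsHermitian) (S : Finset V)
    {m : ℕ} (hS : S.card < m) (f : Fin m → V → ℝ)
    (hf : ∀ a : Fin m → ℝ, a ≠ 0 → 0 < (∑ j, a j • f j) ⬝ᵥ A *ᵥ (∑ j, a j • f j)) :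
    ∃ i, i ∉ S ∧ 0 < hA.eigenvalues i := by
  obtain ⟨a, ha0, ha⟩ := hA.exists_coord_eq_zero_on S hS f
  have h := hf a ha0
  by_contra! hcon
  rw [hA.dotProduct_mulVec_eq_sum] at h
  refine h.not_ge (Finset.sum_nonpos fun i _ => ?_)
  by_cases hi : i ∈ S
  · simp [ha i hi]
  · exact mul_nonpos_of_nonpos_of_nonneg (hcon i hi) (sq_nonneg _)

theorem Matrix.IsHermitian.dotProduct_mulVec_le (hA : A.IsHermitian) {c : ℝ}
    (hc : ∀ i, hA.eigenvalues i ≤ c) (z : V → ℝ) : z ⬝ᵥ A *ᵥ z ≤ c * (z ⬝ᵥ z) := by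
  rw [hA.dotProduct_mulVec_eq_sum, hA.dotProduct_self_eq_sum, Finset.mul_sum]
  exact Finset.sum_le_sum fun i _ => mul_le_mul_of_nonneg_right (hc i) (sq_nonneg _)

end Spectral

section AdjSpectral

variable {V : Type*} [Fintype V] [DecidableEq V] (G : SimpleGraph V) [DecidableRel G.Adj]

open Matrix

theorem SimpleGraph.eigenvalues_le_lambdaOne (i : V) :
    (G.isHermitian_adjMatrix ℝ).eigenvalues i ≤ G.lambdaOne :=
  le_ciSup (Set.finite_range _).bddAbove i

theorem SimpleGraph.exists_eigenvalues_eq_lambdaOne [Nonempty V] :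
    ∃ i, (G.isHermitian_adjMatrix ℝ).eigenvalues i = G.lambdaOne :=
  exists_eq_ciSup_of_finite

theorem SimpleGraph.dotProduct_adjMatrix_mulVec_le (z : V → ℝ) :
    z ⬝ᵥ G.adjMatrix ℝ *ᵥ z ≤ G.lambdaOne * (z ⬝ᵥ z) :=
  (G.isHermitian_adjMatrix ℝ).dotProduct_mulVec_le G.eigenvalues_le_lambdaOne z

theorem SimpleGraph.exists_eigenvector (i : V) :
    ∃ z : V → ℝ, z ≠ 0 ∧
      G.adjMatrix ℝ *ᵥ z = (G.isHermitian_adjMatrix ℝ).eigenvalues i • z := by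
  refine ⟨_, fun h => ?_, (G.isHermitian_adjMatrix ℝ).mulVec_eigenvectorBasis i⟩
  exact (G.isHermitian_adjMatrix ℝ).eigenvectorBasis.toBasis.ne_zero i
    (by simpa using (WithLp.ofLp_injective 2 (h.trans (WithLp.ofLp_zero 2).symm)))

/-- An eigenvalue is no larger in absolute value than `λ₁`: replace its eigenvector by the vector
of absolute values. -/
theorem SimpleGraph.abs_eigenvalues_le_lambdaOne (i : V) :
    |(G.isHermitian_adjMatrix ℝ).eigenvalues i| ≤ G.lambdaOne := by
  obtain ⟨z, hz0, hz⟩ := G.exists_eigenvector i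
  set μ := (G.isHermitian_adjMatrix ℝ).eigenvalues i
  have hpos : 0 < z ⬝ᵥ z := by
    have := dotProduct_star_self_pos_iff.2 hz0; simpa using this
  have h1 : z ⬝ᵥ G.adjMatrix ℝ *ᵥ z = μ * (z ⬝ᵥ z) := by rw [hz, dotProduct_smul, smul_eq_mul]
  have h2 : |z ⬝ᵥ G.adjMatrix ℝ *ᵥ z| ≤ |z| ⬝ᵥ G.adjMatrix ℝ *ᵥ |z| := by
    simp only [dotProduct, mulVec, Finset.mul_sum]
    refine (Finset.abs_sum_le_sum_abs _ _).trans (Finset.sum_le_sum fun u _ => ?_)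
    refine (Finset.abs_sum_le_sum_abs _ _).trans (Finset.sum_le_sum fun w _ => ?_)
    rw [abs_mul, abs_mul, SimpleGraph.adjMatrix_apply]
    split_ifs <;> simp
  have h3 : |z| ⬝ᵥ |z| = z ⬝ᵥ z := by simp [dotProduct]
  have h4 := G.dotProduct_adjMatrix_mulVec_le |z|
  rw [h3] at h4
  rw [h1, abs_mul, abs_of_pos hpos] at h2
  exact le_of_mul_le_mul_right (h2.trans h4) hpos

end AdjSpectral

/-! ### Shortest odd cycles -/

section OddCycle

variable {V : Type*} {G : SimpleGraph V}

/-- `v` is a parametrization, by `ℤ` with period `s`, of an odd closed walk of `G` of length `s`,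
and `G` has no shorter odd closed walk. -/
structure SimpleGraph.IsShortestOddCycle (G : SimpleGraph V) (s : ℕ) (v : ℤ → V) : Prop where
  odd : Odd s
  periodic : Function.Periodic v s
  adj : ∀ i, G.Adj (v i) (v (i + 1))
  le_length : ∀ (u : V) (p : G.Walk u u), Odd p.length → s ≤ p.length

namespace SimpleGraph.IsShortestOddCycle

variable {s : ℕ} {v : ℤ → V}

theorem shift (h : G.IsShortestOddCycle s v) (a : ℤ) :
    G.IsShortestOddCycle s (fun i => v (i + a)) where
  odd := h.odd
  periodic i := by
    have := h.periodic (i + a)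
    rwa [add_right_comm] at this
  adj i := by
    have := h.adj (i + a)
    rwa [add_right_comm] at this
  le_length := h.le_length

theorem reflect (h : G.IsShortestOddCycle s v) : G.IsShortestOddCycle s (fun i => v (-i)) where
  odd := h.odd
  periodic i := by
    have := h.periodic (-i - s)
    rw [sub_add_cancel] at this
    change v (-(i + s)) = v (-i)
    rw [this, neg_add']
  adj i := by
    have := h.adj (-i - 1)
    rw [sub_add_cancel] at this
    rw [neg_add']
    exact this.symm
  le_length := h.le_length

theorem map_emod (h : G.IsShortestOddCycle s v) (i : ℤ) : v (i % s) = v i := by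
  rw [Int.emod_def, mul_comm]
  exact h.periodic.sub_int_mul_eq (i / s)

theorem exists_walk (h : G.IsShortestOddCycle s v) (i : ℤ) (n : ℕ) :
    ∃ p : G.Walk (v i) (v (i + n)), p.length = n := by
  induction n with
  | zero => exact ⟨Walk.nil.copy rfl (by simp), by simp⟩
  | succ n ih =>
    obtain ⟨p, hp⟩ := ih
    exact ⟨(p.concat (h.adj (i + n))).copy rfl (by push_cast; rw [add_assoc]), by simp [hp]⟩

/-- A walk joining two vertices of the cycle closes up to an odd walk with exactly one of the two
arcs between them; by minimality it is at least as long as the other arc. -/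
theorem le_of_walk (h : G.IsShortestOddCycle s v) (i : ℤ) {n : ℕ} (hn : n ≤ s)
    (p : G.Walk (v (i + n)) (v i)) :
    (Odd (n + p.length) → s ≤ n + p.length) ∧ (Even (n + p.length) → n ≤ p.length) := by
  constructor
  · intro hodd
    obtain ⟨q, hq⟩ := h.exists_walk i n
    have := h.le_length _ (q.append p) (by simpa [hq] using hodd)
    simpa [hq] using this
  · intro heven
    obtain ⟨q, hq⟩ := h.exists_walk (i + n) (s - n)
    have hend : v (i + n + (s - n : ℕ)) = v i := by
      rw [Nat.cast_sub hn, add_assoc, add_sub_cancel]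
      exact h.periodic i
    have := h.le_length _ (p.reverse.append (q.copy rfl hend)) (by
      have := h.odd
      simp only [Walk.length_append, Walk.length_reverse, Walk.length_copy, hq]
      grind)
    simp only [Walk.length_append, Walk.length_reverse, Walk.length_copy, hq] at this
    omega

theorem eq_zero_of_eq (h : G.IsShortestOddCycle s v) {i : ℤ} {n : ℕ} (hn : n < s)
    (heq : v (i + n) = v i) : n = 0 := by
  have h1 := h.le_of_walk i hn.le (Walk.nil.copy rfl heq)
  have := h.odd
  simp only [Walk.length_copy, Walk.length_nil] at h1
  grind

theorem of_adj (h : G.IsShortestOddCycle s v) {i : ℤ} {n : ℕ} (hn : n < s)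
    (hadj : G.Adj (v (i + n)) (v i)) : n = 1 ∨ n + 1 = s := by
  have h1 := h.le_of_walk i hn.le hadj.toWalk
  have := h.odd
  have : n ≠ 0 := by rintro rfl; simp at hadj
  simp only [Walk.length_cons, Walk.length_nil] at h1
  grind

theorem of_common_neighbor (h : G.IsShortestOddCycle s v) {i : ℤ} {n : ℕ} (hn : n < s) {p : V}
    (h0 : G.Adj p (v i)) (h1 : G.Adj p (v (i + n))) : n = 0 ∨ n = 2 ∨ n + 2 = s := by
  have h1 := h.le_of_walk i hn.le (Walk.cons h1.symm h0.toWalk)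
  have := h.odd
  simp only [Walk.length_cons, Walk.length_nil] at h1
  grind

theorem three_le (h : G.IsShortestOddCycle s v) : 3 ≤ s := by
  have h1 := h.odd
  have : s ≠ 1 := by
    rintro rfl
    have h2 := h.adj 0
    have h3 := h.periodic 0
    simp only [Nat.cast_one] at h3
    rw [h3] at h2
    exact h2.ne rfl
  grind

theorem eq_of_lt (h : G.IsShortestOddCycle s v) {i j : ℕ} (hi : i < s) (hj : j < s)
    (heq : v i = v j) : i = j := by
  wlog hle : i ≤ j generalizing i j
  · exact (this hj hi heq.symm (le_of_not_ge hle)).symm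
  have := h.eq_zero_of_eq (i := i) (n := j - i) (by omega) (by
    rw [Nat.cast_sub hle, add_sub_cancel]; exact heq.symm)
  omega

theorem injective (h : G.IsShortestOddCycle s v) : Function.Injective fun i : Fin s => v i.val :=
  fun a b hab => Fin.ext (h.eq_of_lt a.isLt b.isLt hab)

theorem sub_one_ne_add_one (h : G.IsShortestOddCycle s v) (i : ℤ) : v (i - 1) ≠ v (i + 1) := by
  intro heq
  have := h.three_le
  have := h.eq_zero_of_eq (i := i - 1) (n := 2) (by omega) (by rw [heq]; congr 1; push_cast; ring)
  omega

theorem adj_iff_of_closed (h : G.IsShortestOddCycle s v)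
    (hcl : ∀ p r, G.Adj p (v r) → p ∈ Set.range v) (i : ℤ) (p : V) :
    G.Adj (v i) p ↔ p = v (i - 1) ∨ p = v (i + 1) := by
  constructor
  · intro hadj
    obtain ⟨j, rfl⟩ := hcl p i hadj.symm
    have hs0 := h.three_le
    have h0 : 0 ≤ (j - i) % s := Int.emod_nonneg _ (by omega)
    have h1 : (j - i) % s < s := Int.emod_lt_of_pos _ (by omega)
    obtain ⟨n, hn⟩ := Int.eq_ofNat_of_zero_le h0
    have hjn : v (i + n) = v j := by
      have hj : j = i + n + (j - i) / s * s := by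
        have := Int.emod_add_mul_ediv (j - i) s
        rw [hn] at this
        linarith
      conv_rhs => rw [hj]
      exact (h.periodic.int_mul _ _).symm
    rw [← hjn] at hadj ⊢
    rcases h.of_adj (by omega) hadj.symm with rfl | hns
    · right; simp
    · left
      rw [← h.periodic (i - 1)]
      congr 1
      omega
  · rintro (rfl | rfl)
    · simpa using (h.adj (i - 1)).symm
    · exact h.adj i

theorem isContained (h : G.IsShortestOddCycle s v) : (cycleGraph s).IsContained G := by
  have hs := h.three_le
  have hstep : ∀ a b : Fin s, (a - b).val = 1 → G.Adj (v b.val) (v a.val) := by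
    intro a b hab
    have hmod : (a.val : ℤ) = ((b.val : ℤ) + 1) % s := by
      rw [Fin.val_sub] at hab
      have h1 : a.val = (b.val + 1) % s := by
        have h2 : (s - b.val + a.val) % s = 1 := hab
        have := a.isLt
        have := b.isLt
        rcases Nat.lt_or_ge (s - b.val + a.val) s with h3 | h3
        · rw [Nat.mod_eq_of_lt h3] at h2
          have : b.val + 1 = s + a.val := by omega
          rw [this, Nat.add_mod_left, Nat.mod_eq_of_lt a.isLt]
        · rw [Nat.mod_eq_sub_mod h3, Nat.mod_eq_of_lt (by omega)] at h2
          rw [Nat.mod_eq_of_lt (by omega)]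
          omega
      exact_mod_cast h1
    rw [hmod, h.map_emod]
    exact h.adj _
  refine ⟨⟨fun i => v i.val, fun {a b} hab => ?_⟩, h.injective⟩
  rcases cycleGraph_adj'.1 hab with h1 | h1
  · exact (hstep a b h1).symm
  · exact hstep b a h1

theorem le_of_shortOddCycleFree (h : G.IsShortestOddCycle s v) {k : ℕ}
    (hfree : G.ShortOddCycleFree k) : 2 * k + 3 ≤ s := by
  by_contra! hlt
  obtain ⟨l, rfl⟩ := h.odd
  have := h.three_le
  exact hfree l (by omega) (by omega) h.isContained

end SimpleGraph.IsShortestOddCycle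

theorem SimpleGraph.exists_isShortestOddCycle (hbip : ¬ G.IsBipartite) :
    ∃ s v, G.IsShortestOddCycle s v := by
  classical
  have hex : ∃ n, ∃ (u : V) (p : G.Walk u u), Odd p.length ∧ p.length = n := by
    by_contra! hcon
    refine hbip (two_colorable_iff_forall_loop_even.2 fun u p => ?_)
    rw [← Nat.not_odd_iff_even]
    exact fun hp => hcon _ u p hp rfl
  obtain ⟨u, p, hodd, hlen⟩ := Nat.find_spec hex
  set s := Nat.find hex with hs
  have hs0 : 0 < s := by rw [← hlen]; exact hodd.pos
  refine ⟨s, fun i => p.getVert (i % s).toNat, hlen ▸ hodd, fun i => by simp, fun i => ?_,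
    fun w q hq => Nat.find_min' hex ⟨w, q, hq, rfl⟩⟩
  have h0 : 0 ≤ i % s := Int.emod_nonneg _ (by omega)
  have h1 : i % s < s := Int.emod_lt_of_pos _ (by omega)
  have hadj := p.adj_getVert_succ (i := (i % s).toNat) (by omega)
  have hend : p.getVert ((i + 1) % s).toNat = p.getVert ((i % s).toNat + 1) := by
    rw [Int.add_emod]
    rcases eq_or_ne s 1 with hs1 | hs1
    · simp [hs1] at hlen ⊢
      rw [← hlen, p.getVert_length]
    rw [Int.emod_eq_of_lt (a := 1) (by omega) (by omega)]
    rcases lt_or_ge (i % s + 1) s with h2 | h2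
    · rw [Int.emod_eq_of_lt (by omega) h2]
      congr 1
      omega
    · have h3 : i % s + 1 = s := by omega
      rw [h3, Int.emod_self, show (i % s).toNat + 1 = p.length by omega, p.getVert_length]
      simp
  simp only [hend]
  exact hadj

end OddCycle

/-! ### Eigenvalue bounds from paths and cycles -/

section TestVectors

open Matrix

variable {V : Type*} [Fintype V] [DecidableEq V]

theorem Matrix.sum_single_dotProduct_mulVec (A : Matrix V V ℝ) {ι κ : Type*} (t : Finset ι)
    (r : Finset κ) (b : ι → ℝ) (d : κ → ℝ) (g : ι → V) (e : κ → V) :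
    (∑ i ∈ t, b i • Pi.single (g i) (1 : ℝ)) ⬝ᵥ A *ᵥ (∑ j ∈ r, d j • Pi.single (e j) (1 : ℝ)) =
      ∑ i ∈ t, ∑ j ∈ r, b i * d j * A (g i) (e j) := by
  rw [mulVec_sum, sum_dotProduct]
  refine Finset.sum_congr rfl fun i _ => ?_
  rw [dotProduct_sum]
  refine Finset.sum_congr rfl fun j _ => ?_
  rw [mulVec_smul, smul_dotProduct, dotProduct_smul]
  simp
  ring

theorem Matrix.sum_single_dotProduct {ι κ : Type*} (t : Finset ι)
    (r : Finset κ) (b : ι → ℝ) (d : κ → ℝ) (g : ι → V) (e : κ → V) :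
    (∑ i ∈ t, b i • Pi.single (g i) (1 : ℝ)) ⬝ᵥ (∑ j ∈ r, d j • Pi.single (e j) (1 : ℝ)) =
      ∑ i ∈ t, ∑ j ∈ r, b i * d j * if g i = e j then 1 else 0 := by
  have h := sum_single_dotProduct_mulVec (1 : Matrix V V ℝ) t r b d g e
  simpa only [one_mulVec, one_apply] using h

variable (G : SimpleGraph V) [DecidableRel G.Adj]

/-- On a path with `k + 1` vertices in `G`, the vector with entries `sin ((i + 1) π / (k + 2))`
has Rayleigh quotient at least `2 cos (π / (k + 2))`; this is the Perron vector of the path. -/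
theorem SimpleGraph.path_rayleigh_le {k : ℕ} {a : ℕ → V} (ha : ∀ i < k, G.Adj (a i) (a (i + 1)))
    (hinj : ∀ i ≤ k, ∀ j ≤ k, a i = a j → i = j) :
    let u : V → ℝ := ∑ i ∈ Finset.range (k + 1),
      Real.sin ((i + 1) * (Real.pi / (k + 2))) • Pi.single (a i) (1 : ℝ)
    u ≠ 0 ∧ 2 * Real.cos (Real.pi / (k + 2)) * (u ⬝ᵥ u) ≤ u ⬝ᵥ G.adjMatrix ℝ *ᵥ u := by
  intro u
  set θ := Real.pi / (k + 2) with hθ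
  set S : ℕ → ℝ := fun i => Real.sin ((i + 1) * θ) with hS
  have hθk : (k + 2) * θ = Real.pi := by rw [hθ]; field_simp
  have hθ0 : 0 < θ := by positivity
  have hpos : ∀ i ≤ k, 0 < S i := by
    intro i hi
    have : (i : ℝ) ≤ k := by exact_mod_cast hi
    refine Real.sin_pos_of_pos_of_lt_pi (by positivity) ?_
    rw [← hθk]
    exact mul_lt_mul_of_pos_right (by linarith) hθ0
  have huu : u ⬝ᵥ u = ∑ i ∈ Finset.range (k + 1), S i * S i := by
    rw [sum_single_dotProduct]
    refine Finset.sum_congr rfl fun i hi => ?_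
    rw [Finset.sum_eq_single_of_mem i hi]
    · rw [if_pos rfl, mul_one]
    · intro j hj hji
      rw [if_neg, mul_zero]
      intro h
      exact hji (hinj i (by simpa [Nat.lt_succ_iff] using hi) j
        (by simpa [Nat.lt_succ_iff] using hj) h).symm
  refine ⟨fun h0 => ?_, ?_⟩
  · rw [h0, zero_dotProduct] at huu
    have : 0 < ∑ i ∈ Finset.range (k + 1), S i * S i := by
      refine Finset.sum_pos (fun i hi => ?_) ⟨0, by simp⟩
      have := hpos i (by simpa [Nat.lt_succ_iff] using hi)
      positivity
    linarith
  rw [huu, sum_single_dotProduct_mulVec, Finset.mul_sum]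
  refine Finset.sum_le_sum fun i hi => ?_
  have hik : i ≤ k := by simpa [Nat.lt_succ_iff] using hi
  have hrec : 2 * Real.cos θ * S i = Real.sin (i * θ) + Real.sin ((i + 2) * θ) := by
    have h1 : (i : ℝ) * θ = (i + 1) * θ - θ := by ring
    have h2 : ((i : ℝ) + 2) * θ = (i + 1) * θ + θ := by ring
    rw [h1, h2, Real.sin_sub, Real.sin_add]
    ring
  -- the two path neighbours of `a i`; at the ends of the path the missing sine vanishes
  have hleft : Real.sin (i * θ) = ∑ j ∈ Finset.range (k + 1), if j + 1 = i then S j else 0 := by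
    rcases i with _ | i
    · simp
    · simp only [Nat.add_right_cancel_iff]
      rw [Finset.sum_ite_eq_of_mem' _ _ _ (by simp; omega)]
      simp [hS]
  have hright : Real.sin ((i + 2) * θ) =
      ∑ j ∈ Finset.range (k + 1), if j = i + 1 then S j else 0 := by
    rcases hik.eq_or_lt with rfl | hlt
    · rw [hθk, Real.sin_pi, Finset.sum_eq_zero]
      intro j hj
      rw [if_neg]
      simp at hj
      omega
    · rw [Finset.sum_ite_eq_of_mem' _ _ _ (by simp; omega)]
      simp only [hS]
      push_cast
      ring_nf
  have hrow : 2 * Real.cos θ * S i ≤ ∑ j ∈ Finset.range (k + 1), S j * G.adjMatrix ℝ (a i) (a j) := by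
    rw [hrec, hleft, hright, ← Finset.sum_add_distrib]
    refine Finset.sum_le_sum fun j hj => ?_
    have hjk : j ≤ k := by simpa [Nat.lt_succ_iff] using hj
    have hj0 := (hpos j hjk).le
    rw [SimpleGraph.adjMatrix_apply]
    by_cases h1 : j + 1 = i
    · have h2 : ¬ j = i + 1 := by omega
      have h3 : G.Adj (a i) (a j) := by rw [← h1]; exact (ha j (by omega)).symm
      simp [h1, h2, h3]
    · by_cases h2 : j = i + 1
      · have h3 : G.Adj (a i) (a j) := by rw [h2]; exact ha i (by omega)
        rw [if_neg h1, if_pos h2, if_pos h3]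
        simp
      · rw [if_neg h1, if_neg h2]
        simp only [add_zero]
        split_ifs <;> simp [hj0]
  have := mul_le_mul_of_nonneg_left hrow (hpos i hik).le
  rw [Finset.mul_sum] at this
  calc 2 * Real.cos θ * (S i * S i) = S i * (2 * Real.cos θ * S i) := by ring
    _ ≤ _ := this
    _ = _ := Finset.sum_congr rfl fun j _ => by simp only [hS]; ring

/-- Two disjoint paths on `k + 1` vertices with no edge between them force an eigenvalue
`≥ 2 cos (π / (k + 2))` besides any given one. -/
theorem SimpleGraph.exists_ne_le_eigenvalues_of_paths {k : ℕ} {a b : ℕ → V}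
    (ha : ∀ i < k, G.Adj (a i) (a (i + 1))) (hb : ∀ i < k, G.Adj (b i) (b (i + 1)))
    (hainj : ∀ i ≤ k, ∀ j ≤ k, a i = a j → i = j) (hbinj : ∀ i ≤ k, ∀ j ≤ k, b i = b j → i = j)
    (hab : ∀ i ≤ k, ∀ j ≤ k, a i ≠ b j) (hnab : ∀ i ≤ k, ∀ j ≤ k, ¬ G.Adj (a i) (b j)) (i₁ : V) :
    ∃ i, i ≠ i₁ ∧ 2 * Real.cos (Real.pi / (k + 2)) ≤ (G.isHermitian_adjMatrix ℝ).eigenvalues i := by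
  obtain ⟨hu0, hu⟩ := G.path_rayleigh_le ha hainj
  obtain ⟨hw0, hw⟩ := G.path_rayleigh_le hb hbinj
  refine (G.isHermitian_adjMatrix ℝ).exists_ne_le_eigenvalues hu0 hw0 ?_ ?_ hu hw i₁
  · rw [sum_single_dotProduct]
    refine Finset.sum_eq_zero fun i hi => Finset.sum_eq_zero fun j hj => ?_
    rw [if_neg (hab i (by simpa [Nat.lt_succ_iff] using hi) j
      (by simpa [Nat.lt_succ_iff] using hj)), mul_zero]
  · rw [sum_single_dotProduct_mulVec]
    refine Finset.sum_eq_zero fun i hi => Finset.sum_eq_zero fun j hj => ?_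
    rw [SimpleGraph.adjMatrix_apply, if_neg (hnab i (by simpa [Nat.lt_succ_iff] using hi) j
      (by simpa [Nat.lt_succ_iff] using hj)), mul_zero]

namespace SimpleGraph.IsShortestOddCycle

variable {G} {s : ℕ} {v : ℤ → V}

/-- A shortest odd cycle of length at least `7` contains an induced path on six vertices. Adding the
indicators of its first, third and fifth edges gives a three-dimensional space on which the
quadratic form of the adjacency matrix is positive definite. -/
theorem exists_third_eigenvalue_pos (h : G.IsShortestOddCycle s v) (hs : 7 ≤ s) {i₁ i₂ : V} :
    ∃ i, i ≠ i₁ ∧ i ≠ i₂ ∧ 0 < (G.isHermitian_adjMatrix ℝ).eigenvalues i := by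
  have hA : ∀ i j : Fin 6, G.adjMatrix ℝ (v i.val) (v j.val) =
      if i.val + 1 = j.val ∨ j.val + 1 = i.val then 1 else 0 := by
    intro i j
    rw [adjMatrix_apply]
    refine if_congr ⟨fun hadj => ?_, ?_⟩ rfl rfl
    · rcases le_total i.val j.val with hij | hij
      · have := h.of_adj (i := i.val) (n := j.val - i.val) (by omega)
          (by rw [Nat.cast_sub hij, add_sub_cancel]; exact hadj.symm)
        omega
      · have := h.of_adj (i := j.val) (n := i.val - j.val) (by omega)
          (by rw [Nat.cast_sub hij, add_sub_cancel]; exact hadj)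
        omega
    · rintro (hij | hij)
      · rw [← hij]; exact_mod_cast h.adj i.val
      · rw [← hij]; exact_mod_cast (h.adj j.val).symm
  obtain ⟨i, hi, hpos⟩ := (G.isHermitian_adjMatrix ℝ).exists_notMem_eigenvalues_pos {i₁, i₂}
    (m := 3) (Finset.card_le_two.trans_lt (by norm_num))
    ![Pi.single (v 0) 1 + Pi.single (v 1) 1, Pi.single (v 2) 1 + Pi.single (v 3) 1,
      Pi.single (v 4) 1 + Pi.single (v 5) 1] (fun a ha => by
    have hz : (∑ j, a j • (![Pi.single (v 0) 1 + Pi.single (v 1) 1,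
        Pi.single (v 2) 1 + Pi.single (v 3) 1,
        Pi.single (v 4) 1 + Pi.single (v 5) 1] : Fin 3 → V → ℝ) j) =
        ∑ i : Fin 6, (![a 0, a 0, a 1, a 1, a 2, a 2] : Fin 6 → ℝ) i •
          Pi.single (v i.val) (1 : ℝ) := by
      simp [Fin.sum_univ_succ, add_assoc]
    rw [hz, sum_single_dotProduct_mulVec]
    simp only [hA]
    have hval : ∑ i : Fin 6, ∑ j : Fin 6, (![a 0, a 0, a 1, a 1, a 2, a 2] : Fin 6 → ℝ) i *
        (![a 0, a 0, a 1, a 1, a 2, a 2] : Fin 6 → ℝ) j *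
        (if i.val + 1 = j.val ∨ j.val + 1 = i.val then 1 else 0) =
        a 0 ^ 2 + (a 0 + a 1) ^ 2 + (a 1 + a 2) ^ 2 + a 2 ^ 2 := by
      simp [Fin.sum_univ_succ]
      ring
    rw [hval]
    by_contra! hle
    have h0 : a 0 = 0 := by
      nlinarith [sq_nonneg (a 0), sq_nonneg (a 0 + a 1), sq_nonneg (a 1 + a 2), sq_nonneg (a 2)]
    have h2 : a 2 = 0 := by
      nlinarith [sq_nonneg (a 0), sq_nonneg (a 0 + a 1), sq_nonneg (a 1 + a 2), sq_nonneg (a 2)]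
    have h1 : a 1 = 0 := by
      rw [h0, h2] at hle
      nlinarith [sq_nonneg (a 1)]
    apply ha
    ext j
    fin_cases j <;> simp [h0, h1, h2])
  simp only [Finset.mem_insert, Finset.mem_singleton, not_or] at hi
  exact ⟨i, hi.1, hi.2, hpos⟩

end SimpleGraph.IsShortestOddCycle

end TestVectors

/-! ### A numerical inequality for central binomial coefficients -/

theorem four_mul_four_pow_le_mul_centralBinom {k : ℕ} (hk : 10 ≤ k) :
    4 * 4 ^ k ≤ (2 * k + 3) * k.centralBinom := by
  induction k, hk using Nat.le_induction with
  | base => decide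
  | succ n hn ih =>
    have h := Nat.succ_mul_centralBinom_succ n
    have h1 : (n + 1) * (2 * n + 3) * (4 * 4 ^ (n + 1)) ≤
        (n + 1) * (2 * n + 3) * ((2 * (n + 1) + 3) * (n + 1).centralBinom) := by
      calc (n + 1) * (2 * n + 3) * (4 * 4 ^ (n + 1))
          = 4 * ((n + 1) * (2 * n + 3)) * (4 * 4 ^ n) := by ring
        _ ≤ 2 * ((2 * n + 5) * (2 * n + 1)) * (4 * 4 ^ n) :=
            Nat.mul_le_mul_right _ (by nlinarith)
        _ ≤ 2 * ((2 * n + 5) * (2 * n + 1)) * ((2 * n + 3) * n.centralBinom) :=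
            Nat.mul_le_mul_left _ ih
        _ = (2 * n + 3) * (2 * n + 5) * (2 * (2 * n + 1) * n.centralBinom) := by ring
        _ = _ := by rw [← h]; ring
    exact le_of_mul_le_mul_left h1 (by positivity)

theorem two_mul_cos_pow_lt_mul_centralBinom {k : ℕ} (hk : 2 ≤ k) :
    2 * ((2 : ℝ) ^ (2 * k) + (2 * Real.cos (Real.pi / (k + 2))) ^ (2 * k)) <
      (2 * k + 3) * k.centralBinom := by
  have hx0 : 0 < Real.pi / ((k : ℝ) + 2) := by positivity
  have hx1 : Real.pi / ((k : ℝ) + 2) ≤ Real.pi / 2 := by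
    have : (0 : ℝ) ≤ k := by positivity
    gcongr
    linarith
  have hc0 : 0 ≤ Real.cos (Real.pi / (k + 2)) :=
    Real.cos_nonneg_of_neg_pi_div_two_le_of_le (by linarith) hx1
  have h4 : (2 : ℝ) ^ (2 * k) = 4 ^ k := by rw [pow_mul]; norm_num
  rw [mul_pow, h4, pow_mul (Real.cos _)]
  rcases Nat.lt_or_ge k 10 with hk10 | hk10
  · rcases hk.eq_or_lt with rfl | hk3
    · have h : Real.pi / ((2 : ℕ) + 2) = Real.pi / 4 := by norm_num
      rw [h, Real.cos_pi_div_four, div_pow, Real.sq_sqrt (by norm_num)]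
      norm_num [Nat.centralBinom, Nat.choose]
    -- for `3 ≤ k ≤ 9` the bound `cos² x ≤ 1 / (x² + 1)` suffices
    have hcos : Real.cos (Real.pi / (k + 2)) ^ 2 ≤ ((3.14 / ((k : ℝ) + 2)) ^ 2 + 1)⁻¹ := by
      have h1 := Real.cos_le_one_div_sqrt_sq_add_one (x := Real.pi / ((k : ℝ) + 2))
        (by linarith [Real.pi_pos]) (by linarith [Real.pi_pos])
      have h2 := pow_le_pow_left₀ hc0 h1 2
      rw [div_pow, Real.sq_sqrt (by positivity), one_pow, one_div] at h2
      refine h2.trans ?_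
      have := Real.pi_gt_d2
      gcongr
    have h1 := pow_le_pow_left₀ (sq_nonneg _) hcos k
    have h2 := mul_le_mul_of_nonneg_left h1 (show (0 : ℝ) ≤ 2 * 4 ^ k by positivity)
    have h3 : 2 * (4 : ℝ) ^ k + 2 * 4 ^ k * (((3.14 / ((k : ℝ) + 2)) ^ 2 + 1)⁻¹) ^ k <
        (2 * k + 3) * k.centralBinom := by
      clear h2 h1 hcos hc0 hx1 hx0 h4
      interval_cases k <;> norm_num [Nat.centralBinom, Nat.choose]
    linarith
  · have h1 : (4 : ℝ) * 4 ^ k ≤ (2 * k + 3) * k.centralBinom := by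
      exact_mod_cast four_mul_four_pow_le_mul_centralBinom hk10
    have hsin : 0 < Real.sin (Real.pi / (k + 2)) :=
      Real.sin_pos_of_pos_of_lt_pi hx0 (by linarith [Real.pi_pos])
    have h2 : Real.cos (Real.pi / (k + 2)) ^ 2 < 1 := by
      have := Real.sin_sq_add_cos_sq (Real.pi / (k + 2))
      nlinarith
    have h3 := pow_lt_one₀ (sq_nonneg _) h2 (show k ≠ 0 by omega)
    have h4 : (0 : ℝ) < 4 ^ k := by positivity
    nlinarith

/-! ### The strict inequality for `k ≥ 2` -/

section Strict

open Matrix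

variable {V : Type*} [Fintype V] [DecidableEq V] {G : SimpleGraph V} [DecidableRel G.Adj]

theorem SimpleGraph.adjMatrix_pow_nonneg (n : ℕ) (u w : V) : 0 ≤ (G.adjMatrix ℝ ^ n) u w := by
  rw [adjMatrix_pow_apply_eq_card_walk]
  positivity

namespace SimpleGraph.IsShortestOddCycle

variable {s : ℕ} {v : ℤ → V}

theorem trace_pow_eq_zero (h : G.IsShortestOddCycle s v) {n : ℕ} (hn : Odd n) (hns : n < s) :
    (G.adjMatrix ℝ ^ n).trace = 0 := by
  refine Finset.sum_eq_zero fun u _ => ?_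
  rw [diag_apply, adjMatrix_pow_apply_eq_card_walk, Nat.cast_eq_zero, Fintype.card_eq_zero_iff]
  refine ⟨fun ⟨p, hp⟩ => ?_⟩
  have hp : p.length = n := hp
  have := h.le_length u p (by rw [hp]; exact hn)
  omega

theorem pow_lambdaOne_lt_of_second (h : G.IsShortestOddCycle s v) {k : ℕ} (hk : 2 ≤ k)
    (hs : 2 * k + 3 ≤ s)
    (h2 : ∀ i₁, (G.isHermitian_adjMatrix ℝ).eigenvalues i₁ = G.lambdaOne →
      ∃ i, i ≠ i₁ ∧ 2 * Real.cos (Real.pi / (k + 2)) ≤ (G.isHermitian_adjMatrix ℝ).eigenvalues i) :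
    2 * (G.lambdaOne ^ (2 * k) + (2 * Real.cos (Real.pi / (k + 2))) ^ (2 * k)) <
      (G.adjMatrix ℝ ^ (2 * k)).trace := by
  have : Nonempty V := ⟨v 0⟩
  obtain ⟨i₁, hi₁⟩ := G.exists_eigenvalues_eq_lambdaOne
  obtain ⟨i₂, h12, hi₂⟩ := h2 i₁ hi₁
  obtain ⟨i₃, h13, h23, hi₃⟩ := h.exists_third_eigenvalue_pos (by omega) (i₁ := i₁) (i₂ := i₂)
  have hc : 0 < 2 * Real.cos (Real.pi / ((k : ℝ) + 2)) := by
    have hk0 : (0 : ℝ) < k := by exact_mod_cast (by omega : 0 < k)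
    have : Real.pi / ((k : ℝ) + 2) < Real.pi / 2 :=
      div_lt_div_of_pos_left Real.pi_pos (by norm_num) (by linarith)
    have : 0 < Real.pi / ((k : ℝ) + 2) := by positivity
    have := Real.cos_pos_of_mem_Ioo (x := Real.pi / ((k : ℝ) + 2))
      ⟨by linarith, by linarith⟩
    linarith
  have hodd := h.trace_pow_eq_zero (n := 2 * k + 1) (by simp) (by omega)
  rw [(G.isHermitian_adjMatrix ℝ).trace_pow_eq_sum] at hodd ⊢
  rw [← hi₁]
  exact two_mul_pow_add_pow_lt_sum_pow _ (by omega) (by simp) hc h12 h13 h23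
    (fun i => by rw [hi₁]; exact G.abs_eigenvalues_le_lambdaOne i) hi₂ hi₃ hodd

/-- A shortest odd cycle of length at least `2k + 5` contains two paths on `k + 1` vertices,
`v 0, …, v k` and `v (k + 2), …, v (2k + 2)`, that are disjoint and not joined by an edge. -/
theorem second_of_long (h : G.IsShortestOddCycle s v) {k : ℕ} (hs : 2 * k + 5 ≤ s) (i₁ : V) :
    ∃ i, i ≠ i₁ ∧
      2 * Real.cos (Real.pi / (k + 2)) ≤ (G.isHermitian_adjMatrix ℝ).eigenvalues i := by
  have hinj (r : ℤ) : ∀ i ≤ k, ∀ j ≤ k, v (r + i) = v (r + j) → i = j := by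
    intro i hi j hj heq
    wlog hij : i ≤ j generalizing i j
    · exact (this j hj i hi heq.symm (le_of_not_ge hij)).symm
    have := h.eq_zero_of_eq (i := r + i) (n := j - i) (by omega) (by
      rw [Nat.cast_sub hij, add_assoc, add_sub_cancel, heq])
    omega
  have hadj (r : ℤ) : ∀ i < k, G.Adj (v (r + i)) (v (r + (i + 1 : ℕ))) := by
    intro i _
    push_cast
    rw [← add_assoc]
    exact h.adj _
  have hidx : ∀ i ≤ k, ∀ j ≤ k, ((k + 2 : ℕ) : ℤ) + j = 0 + i + ((k + 2 + j - i : ℕ) : ℤ) := by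
    intro i hi j hj
    omega
  refine G.exists_ne_le_eigenvalues_of_paths (a := fun i => v (0 + i))
    (b := fun i => v ((k + 2 : ℕ) + i)) (hadj _) (hadj _) (hinj _) (hinj _) ?_ ?_ i₁
  · intro i hi j hj heq
    simp only [hidx i hi j hj] at heq
    have := h.eq_zero_of_eq (by omega) heq.symm
    omega
  · intro i hi j hj hadj
    simp only [hidx i hi j hj] at hadj
    have := h.of_adj (by omega) hadj.symm
    omega

/-- A vertex `p` outside a shortest odd cycle of length `2k + 3`, adjacent to `v 0`, prolongs the
path `v 0, …, v (k - 1)`; by reflection, `p` may be assumed not to be adjacent to `v (-2)`, and then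
the path `v (k + 1), …, v (2k + 1)` is disjoint from and not joined to it. -/
theorem second_of_adj_outside (h : G.IsShortestOddCycle s v) {k : ℕ} (hk : 2 ≤ k)
    (hs : s = 2 * k + 3) {p : V} (hp : p ∉ Set.range v) {r : ℤ} (hpr : G.Adj p (v r)) (i₁ : V) :
    ∃ i, i ≠ i₁ ∧
      2 * Real.cos (Real.pi / (k + 2)) ≤ (G.isHermitian_adjMatrix ℝ).eigenvalues i := by
  wlog hr : r = 0 generalizing v r
  · exact this (h.shift r) (fun ⟨j, hj⟩ => hp ⟨j + r, hj⟩) (r := 0) (by simpa using hpr) rfl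
  subst hr
  -- `p` cannot be adjacent to both `v (-2)` and `v 2`, which are at distance four in the cycle
  wlog hp2 : ¬ G.Adj p (v (-2)) generalizing v
  · refine this h.reflect (fun ⟨j, hj⟩ => hp ⟨-j, hj⟩) (by simpa using hpr) fun hcon => ?_
    rw [not_not] at hp2
    have := h.of_common_neighbor (i := -2) (n := 4) (by omega) hp2 (by simpa using hcon)
    omega
  have hdiff : ∀ i < k, ∀ j ≤ k,
      ((k + 1 : ℕ) : ℤ) + j = i + ((k + 1 + j - i : ℕ) : ℤ) := by
    intro i hi j hj
    omega
  refine G.exists_ne_le_eigenvalues_of_paths (k := k)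
    (a := fun i => if i = 0 then p else v (i - 1 : ℕ))
    (b := fun i => v ((k + 1 : ℕ) + i)) ?_ ?_ ?_ ?_ ?_ ?_ i₁
  · rintro (_ | i) _
    · simpa using hpr
    · simpa using h.adj i
  · intro i _
    push_cast
    rw [← add_assoc]
    exact h.adj _
  · rintro (_ | i) hi (_ | j) hj heq
    · rfl
    · exact absurd ⟨_, by simpa using heq.symm⟩ hp
    · exact absurd ⟨_, by simpa using heq⟩ hp
    · have := h.eq_of_lt (i := i) (j := j) (by omega) (by omega) (by simpa using heq)
      omega
  · intro i hi j hj heq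
    have := h.eq_of_lt (i := k + 1 + i) (j := k + 1 + j) (by omega) (by omega)
      (by push_cast; exact_mod_cast heq)
    omega
  · rintro (_ | i) hi j hj heq
    · exact hp ⟨_, by simpa using heq.symm⟩
    · simp only [hdiff i (by omega) j hj] at heq
      have := h.eq_zero_of_eq (i := i) (n := k + 1 + j - i) (by omega) (by simpa using heq.symm)
      omega
  · rintro (_ | i) hi j hj hadj
    · have hpj : G.Adj p (v (0 + (k + 1 + j : ℕ))) := by simpa using hadj
      have := h.of_common_neighbor (by omega) hpr hpj
      have hj : ((0 : ℤ) + (k + 1 + j : ℕ)) = -2 + s := by omega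
      rw [hj, h.periodic (-2)] at hpj
      exact hp2 hpj
    · simp only [hdiff i (by omega) j hj] at hadj
      have := h.of_adj (i := i) (n := k + 1 + j - i) (by omega) (by simpa using hadj.symm)
      omega

/-- The indicator of a shortest odd cycle that is a connected component is an eigenvector with
eigenvalue `2`. -/
theorem adjMatrix_mulVec_indicator (h : G.IsShortestOddCycle s v)
    (hcl : ∀ p r, G.Adj p (v r) → p ∈ Set.range v) :
    G.adjMatrix ℝ *ᵥ (Set.range v).indicator 1 = (2 : ℝ) • (Set.range v).indicator 1 := by
  classical
  ext w
  rw [adjMatrix_mulVec_apply]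
  by_cases hw : w ∈ Set.range v
  · obtain ⟨i, rfl⟩ := hw
    have hN : G.neighborFinset (v i) = {v (i - 1), v (i + 1)} := by
      ext p
      simp [h.adj_iff_of_closed hcl]
    rw [hN, Finset.sum_pair (h.sub_one_ne_add_one i)]
    simp
    norm_num
  · rw [Finset.sum_eq_zero]
    · simp [hw]
    · intro p hp
      rw [Set.indicator_of_notMem]
      rintro ⟨j, rfl⟩
      exact hw (hcl w j (by simpa using hp))

theorem choose_le_adjMatrix_pow (h : G.IsShortestOddCycle s v) (a : ℤ) (n j : ℕ) :
    (n.choose j : ℝ) ≤ (G.adjMatrix ℝ ^ n) (v a) (v (a + n - 2 * j)) := by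
  induction n generalizing j with
  | zero =>
    rcases j with _ | j
    · simp
    · simpa using adjMatrix_pow_nonneg (G := G) 0 _ _
  | succ n ih =>
    set b : ℤ := a + (n + 1 : ℕ) - 2 * j with hb
    have hstep : (G.adjMatrix ℝ ^ n) (v a) (v (b - 1)) + (G.adjMatrix ℝ ^ n) (v a) (v (b + 1)) ≤
        (G.adjMatrix ℝ ^ (n + 1)) (v a) (v b) := by
      rw [pow_succ, Matrix.mul_apply]
      have hsub := Finset.sum_le_univ_sum_of_nonneg
        (f := fun x => (G.adjMatrix ℝ ^ n) (v a) x * G.adjMatrix ℝ x (v b))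
        (s := {v (b - 1), v (b + 1)}) (fun x => mul_nonneg (adjMatrix_pow_nonneg n _ _) (by
          rw [adjMatrix_apply]; split_ifs <;> simp))
      rw [Finset.sum_pair (h.sub_one_ne_add_one b)] at hsub
      have h1 : G.Adj (v (b - 1)) (v b) := by simpa using h.adj (b - 1)
      have h2 : G.Adj (v (b + 1)) (v b) := (h.adj b).symm
      simpa [adjMatrix_apply, h1, h2] using hsub
    refine le_trans ?_ hstep
    rcases j with _ | j
    · have h1 := ih 0
      have h2 := adjMatrix_pow_nonneg (G := G) n (v a) (v (b + 1))
      have hb1 : a + n - 2 * (0 : ℕ) = b - 1 := by rw [hb]; push_cast; ring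
      rw [hb1] at h1
      simp only [Nat.choose_zero_right] at h1 ⊢
      linarith
    · have h1 := ih (j + 1)
      have h2 := ih j
      have hb1 : a + n - 2 * (j + 1 : ℕ) = b - 1 := by rw [hb]; push_cast; ring
      have hb2 : a + n - 2 * (j : ℕ) = b + 1 := by rw [hb]; push_cast; ring
      rw [hb1] at h1
      rw [hb2] at h2
      rw [Nat.choose_succ_succ]
      push_cast
      linarith

theorem mul_centralBinom_le_trace (h : G.IsShortestOddCycle s v) (k : ℕ) :
    (s : ℝ) * k.centralBinom ≤ (G.adjMatrix ℝ ^ (2 * k)).trace := by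
  have hsub := Finset.sum_le_univ_sum_of_nonneg (f := fun x => (G.adjMatrix ℝ ^ (2 * k)) x x)
    (s := Finset.univ.map ⟨_, h.injective⟩) (fun x => adjMatrix_pow_nonneg _ _ _)
  refine le_trans ?_ hsub
  rw [Finset.sum_map]
  have : (s : ℝ) * k.centralBinom = ∑ _i : Fin s, (k.centralBinom : ℝ) := by simp
  rw [this]
  refine Finset.sum_le_sum fun i _ => ?_
  have := h.choose_le_adjMatrix_pow i (2 * k) k
  rw [Nat.centralBinom]
  simpa using this

/-- The strict inequality when a shortest odd cycle of length `2k + 3` is a component of `G`: either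
another component gives `λ₁ > 2`, and `2` is a second large eigenvalue, or `λ₁ = 2`, and counting
closed walks inside the cycle is enough. -/
theorem pow_lambdaOne_lt_of_closed (h : G.IsShortestOddCycle s v) {k : ℕ} (hk : 2 ≤ k)
    (hs : s = 2 * k + 3) (hcl : ∀ p r, G.Adj p (v r) → p ∈ Set.range v) :
    2 * (G.lambdaOne ^ (2 * k) + (2 * Real.cos (Real.pi / (k + 2))) ^ (2 * k)) <
      (G.adjMatrix ℝ ^ (2 * k)).trace := by
  rcases lt_or_ge 2 G.lambdaOne with hlam | hlam
  · refine h.pow_lambdaOne_lt_of_second hk hs.ge fun i₁ hi₁ => ?_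
    have hz0 : (Set.range v).indicator (1 : V → ℝ) ≠ 0 := by
      intro h0
      have := congrFun h0 (v 0)
      simp at this
    obtain ⟨i, hi⟩ := (G.isHermitian_adjMatrix ℝ).exists_coord_ne_zero hz0
    have h1 := (G.isHermitian_adjMatrix ℝ).coord_mulVec ((Set.range v).indicator 1) i
    rw [h.adjMatrix_mulVec_indicator hcl, Matrix.IsHermitian.coord, mulVec_smul, Pi.smul_apply,
      smul_eq_mul] at h1
    have h2 := mul_right_cancel₀ hi h1
    refine ⟨i, ?_, ?_⟩
    · rintro rfl
      linarith
    · rw [← h2]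
      linarith [Real.cos_le_one (Real.pi / (k + 2))]
  · have h0 : 0 ≤ G.lambdaOne := (abs_nonneg _).trans (G.abs_eigenvalues_le_lambdaOne (v 0))
    have h1 := pow_le_pow_left₀ h0 hlam (2 * k)
    have h2 := two_mul_cos_pow_lt_mul_centralBinom hk
    have h3 := h.mul_centralBinom_le_trace k
    rw [hs] at h3
    push_cast at h3
    linarith

end SimpleGraph.IsShortestOddCycle

theorem SimpleGraph.pow_lambdaOne_lt {k : ℕ} (hk : 2 ≤ k) (hbip : ¬ G.IsBipartite)
    (hfree : G.ShortOddCycleFree k) :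
    2 * (G.lambdaOne ^ (2 * k) + (2 * Real.cos (Real.pi / (k + 2))) ^ (2 * k)) <
      (G.adjMatrix ℝ ^ (2 * k)).trace := by
  obtain ⟨s, v, h⟩ := exists_isShortestOddCycle hbip
  have hs := h.le_of_shortOddCycleFree hfree
  have hodd := h.odd
  by_cases hlong : 2 * k + 5 ≤ s
  · exact h.pow_lambdaOne_lt_of_second hk hs fun i₁ _ => h.second_of_long hlong i₁
  have hs' : s = 2 * k + 3 := by grind
  by_cases hcl : ∀ p r, G.Adj p (v r) → p ∈ Set.range v
  · exact h.pow_lambdaOne_lt_of_closed hk hs' hcl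
  · push Not at hcl
    obtain ⟨p, r, hpr, hp⟩ := hcl
    exact h.pow_lambdaOne_lt_of_second hk hs fun i₁ _ => h.second_of_adj_outside hk hs' hp hpr i₁

end Strict

/-! ### Triangle-free graphs: the case `k = 1` -/

section TriangleFree

variable {V : Type*} {G : SimpleGraph V}

theorem SimpleGraph.not_adj_of_shortOddCycleFree_one (hfree : G.ShortOddCycleFree 1)
    (hbip : ¬ G.IsBipartite) {x y z : V} (hxy : G.Adj x y) (hyz : G.Adj y z) : ¬ G.Adj z x := by
  intro hzx
  obtain ⟨s, v, h⟩ := exists_isShortestOddCycle hbip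
  have h1 := h.le_of_shortOddCycleFree hfree
  have h2 := h.le_length x (Walk.cons hxy (Walk.cons hyz hzx.toWalk)) (by
    simp only [Walk.length_cons, Walk.length_nil]; decide)
  simp only [Walk.length_cons, Walk.length_nil] at h2
  omega

theorem SimpleGraph.exists_adj_of_not_isBipartite (hbip : ¬ G.IsBipartite) (T : Set V) :
    ∃ x y, G.Adj x y ∧ (x ∈ T ↔ y ∈ T) := by
  classical
  by_contra! h
  refine hbip ⟨Coloring.mk (fun x => if x ∈ T then (0 : Fin 2) else 1) fun {x y} hxy => ?_⟩
  have := h x y hxy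
  by_cases hx : x ∈ T <;> by_cases hy : y ∈ T <;> simp_all

/-- A pentagon such that for each of its vertices `w` the opposite edge is the only edge of `G`
disjoint from the neighbourhood of `w` contains all edges of a triangle-free graph: each vertex of
the pentagon would be adjacent to an end of any other edge, and no end can be adjacent to two
consecutive vertices of the pentagon. -/
theorem SimpleGraph.isC5WithIsolated_of_pentagon [Fintype V]
    (htri : ∀ {x y z}, G.Adj x y → G.Adj y z → ¬ G.Adj z x) (c : Fin 5 → V)
    (hc : ∀ i, G.Adj (c i) (c (i + 1)))
    (hmiss : ∀ i x y, G.Adj x y → ¬ G.Adj (c i) x → ¬ G.Adj (c i) y →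
      (x = c (i + 2) ∧ y = c (i + 3)) ∨ (x = c (i + 3) ∧ y = c (i + 2))) :
    G.IsC5WithIsolated := by
  classical
  have hinj : Function.Injective c := by
    have h1 : ∀ i, c i ≠ c (i + 1) := fun i => (hc i).ne
    have h2 : ∀ i, c i ≠ c (i + 2) := by
      intro i heq
      have h3 := hc (i + 2)
      have h4 := hc (i + 2 + 1)
      have h5 := hc (i + 2 + 1 + 1)
      rw [show i + 2 + 1 + 1 + 1 = i by omega, heq] at h5
      exact htri h3 h4 h5
    intro i j hij
    by_contra hne
    have hcases : j = i + 1 ∨ j = i + 2 ∨ i = j + 1 ∨ i = j + 2 := by omega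
    rcases hcases with rfl | rfl | rfl | rfl
    exacts [h1 _ hij, h2 _ hij, h1 _ hij.symm, h2 _ hij.symm]
  have hedge : ∀ x y, G.Adj x y → ∃ i, (x = c i ∧ y = c (i + 1)) ∨ (x = c (i + 1) ∧ y = c i) := by
    intro x y hxy
    by_contra! hcon
    have hor : ∀ i, G.Adj (c i) x ∨ G.Adj (c i) y := by
      intro i
      by_contra! hi
      have h3 : i + 3 = i + 2 + 1 := by omega
      rcases hmiss i x y hxy hi.1 hi.2 with h | h
      · exact (hcon (i + 2)).1 h.1 (h3 ▸ h.2)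
      · exact (hcon (i + 2)).2 (h3 ▸ h.1) h.2
    have hx : ∀ i, G.Adj (c i) x → ¬ G.Adj (c (i + 1)) x := fun i hi hi1 =>
      htri (hc i) hi1 hi.symm
    have hy : ∀ i, G.Adj (c i) y → ¬ G.Adj (c (i + 1)) y := fun i hi hi1 =>
      htri (hc i) hi1 hi.symm
    -- a proper 2-colouring of the pentagon by the two ends of the edge
    have hxy' : ∀ i, G.Adj (c i) x → G.Adj (c (i + 2)) x := fun i hi =>
      (hor (i + 2)).resolve_right fun hi2 => by
        rw [show i + 2 = i + 1 + 1 by omega] at hi2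
        exact hy (i + 1) ((hor (i + 1)).resolve_left (hx i hi)) hi2
    have hx0 : ∀ i, ¬ G.Adj (c i) x := fun i hi => by
      have h4 := hxy' _ (hxy' i hi)
      refine hx _ h4 ?_
      rwa [show i + 2 + 2 + 1 = i by omega]
    exact hy 0 ((hor 0).resolve_left (hx0 0)) ((hor (0 + 1)).resolve_left (hx0 (0 + 1)))
  let f : Fin 5 ⊕ Fin (Fintype.card ((Set.range c)ᶜ : Set V)) ≃ V :=
    (Equiv.sumCongr (Equiv.ofInjective c hinj) (Fintype.equivFin _).symm).trans
      (Equiv.Set.sumCompl (Set.range c))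
  have hfl : ∀ i, f (.inl i) = c i := fun i => by simp [f]
  have hfr : ∀ j i, f (.inr j) ≠ c i := fun j i heq => by
    rw [← hfl] at heq
    simpa using f.injective heq
  refine ⟨_, ⟨RelIso.symm ⟨f, ?_⟩⟩⟩
  rintro (i | j) (i' | j')
  · rw [hfl, hfl, sum_adj_inl, cycleGraph_adj]
    constructor
    · intro h
      obtain ⟨r, ⟨h1, h2⟩ | ⟨h1, h2⟩⟩ := hedge _ _ h
      · rw [hinj h1, hinj h2]; right; exact add_sub_cancel_left r 1
      · rw [hinj h1, hinj h2]; left; exact add_sub_cancel_left r 1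
    · rintro (h | h)
      · obtain rfl : i = i' + 1 := sub_eq_iff_eq_add'.1 h
        exact (hc i').symm
      · obtain rfl : i' = i + 1 := sub_eq_iff_eq_add'.1 h
        exact hc i
  · refine iff_of_false (fun h => ?_) (by simp)
    obtain ⟨r, ⟨-, h2⟩ | ⟨-, h2⟩⟩ := hedge _ _ h <;> exact hfr _ _ h2
  · refine iff_of_false (fun h => ?_) (by simp)
    obtain ⟨r, ⟨h2, -⟩ | ⟨h2, -⟩⟩ := hedge _ _ h <;> exact hfr _ _ h2
  · refine iff_of_false (fun h => ?_) (by simp)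
    obtain ⟨r, ⟨h2, -⟩ | ⟨h2, -⟩⟩ := hedge _ _ h <;> exact hfr _ _ h2

/-- If `S ≠ ∅` is closed under walks of length two and each vertex of `S` has exactly one edge
disjoint from its neighbourhood, then a non-bipartite triangle-free graph is a pentagon up to
isolated vertices. -/
theorem SimpleGraph.isC5WithIsolated_of_closed [Fintype V] (hbip : ¬ G.IsBipartite)
    (htri : ∀ {x y z}, G.Adj x y → G.Adj y z → ¬ G.Adj z x) (S : Set V) {w : V} (hw : w ∈ S)
    (hS : ∀ x y z, x ∈ S → G.Adj x y → G.Adj y z → z ∈ S)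
    (huniq : ∀ w ∈ S, ∀ x y x' y', G.Adj x y → ¬ G.Adj w x → ¬ G.Adj w y →
      G.Adj x' y' → ¬ G.Adj w x' → ¬ G.Adj w y' → (x' = x ∧ y' = y) ∨ (x' = y ∧ y' = x)) :
    G.IsC5WithIsolated := by
  obtain ⟨y, z, hyz, hwyz⟩ := exists_adj_of_not_isBipartite hbip (G.neighborSet w)
  simp only [mem_neighborSet] at hwyz
  have hwy : ¬ G.Adj w y := fun h => htri h hyz (hwyz.1 h).symm
  have hwz : ¬ G.Adj w z := fun h => hwy (hwyz.2 h)
  -- otherwise moving `y` to the side of `N(w)` would give a bipartition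
  have hnbr : ∀ y z, G.Adj y z → ¬ G.Adj w y → ¬ G.Adj w z → ∃ a, G.Adj w a ∧ G.Adj a y := by
    intro y z hyz hwy hwz
    obtain ⟨p, q, hpq, hT⟩ := exists_adj_of_not_isBipartite hbip (insert y (G.neighborSet w))
    simp only [Set.mem_insert_iff, mem_neighborSet] at hT
    by_cases hp : p = y ∨ G.Adj w p
    · rcases hp with rfl | hp <;> rcases hT.1 (by tauto) with rfl | hq
      · exact absurd rfl hpq.ne
      · exact ⟨q, hq, hpq.symm⟩
      · exact ⟨p, hp, hpq⟩
      · exact absurd hq.symm (htri hp hpq)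
    · have hq : ¬ (q = y ∨ G.Adj w q) := fun h => hp (hT.2 h)
      rcases huniq w hw y z p q hyz hwy hwz hpq (by tauto) (by tauto) with h | h <;> tauto
  obtain ⟨a, hwa, hay⟩ := hnbr y z hyz hwy hwz
  obtain ⟨b, hwb, hbz⟩ := hnbr z y hyz.symm hwz hwy
  have hyS : y ∈ S := hS w a y hw hwa hay
  have hzS : z ∈ S := hS w b z hw hwb hbz
  have haS : a ∈ S := hS z y a hzS hyz.symm hay.symm
  have hbS : b ∈ S := hS y z b hyS hyz hbz.symm
  have hc : ∀ i, G.Adj ((![w, a, y, z, b] : Fin 5 → V) i)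
      ((![w, a, y, z, b] : Fin 5 → V) (i + 1)) := by
    intro i
    fin_cases i
    exacts [hwa, hay, hyz, hbz.symm, hwb.symm]
  have hmem : ∀ i, (![w, a, y, z, b] : Fin 5 → V) i ∈ S := by
    intro i
    fin_cases i
    exacts [hw, haS, hyS, hzS, hbS]
  refine isC5WithIsolated_of_pentagon htri ![w, a, y, z, b] hc fun i p q hpq hp hq => ?_
  generalize (![w, a, y, z, b] : Fin 5 → V) = c at *
  have h0 := hc i
  have h1 := hc (i + 1)
  have h2 := hc (i + 2)
  have h3 := hc (i + 3)
  have h4 := hc (i + 4)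
  rw [show i + 1 + 1 = i + 2 by omega] at h1
  rw [show i + 2 + 1 = i + 3 by omega] at h2
  rw [show i + 3 + 1 = i + 4 by omega] at h3
  rw [show i + 4 + 1 = i by omega] at h4
  exact huniq (c i) (hmem i) _ _ p q h2 (fun h => htri h0 h1 h.symm) (fun h => htri h h3 h4)
    hpq hp hq

end TriangleFree

section TriangleFreeSpectral

open Matrix

variable {V : Type*} [Fintype V] [DecidableEq V] (G : SimpleGraph V) [DecidableRel G.Adj]

theorem SimpleGraph.trace_adjMatrix_sq :
    (G.adjMatrix ℝ ^ 2).trace = ∑ x, ∑ y, G.adjMatrix ℝ x y := by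
  rw [pow_two, Matrix.trace]
  refine Finset.sum_congr rfl fun x _ => ?_
  rw [diag_apply, Matrix.mul_apply]
  refine Finset.sum_congr rfl fun y _ => ?_
  simp [adjMatrix_apply, G.adj_comm y x]

/-- The ordered pairs of adjacent vertices, neither of which is a neighbour of `w`. -/
def SimpleGraph.missedDarts (w : V) : Finset (V × V) :=
  Finset.univ.filter fun p => G.Adj p.1 p.2 ∧ ¬ G.Adj w p.1 ∧ ¬ G.Adj w p.2

variable {G}

/-- In a triangle-free graph the neighbourhood of `w` is independent, so the walks of length two
from `w` count each edge meeting it exactly once. -/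
theorem SimpleGraph.two_mul_row_sum_add_card_missedDarts
    (htri : ∀ {x y z}, G.Adj x y → G.Adj y z → ¬ G.Adj z x) (w : V) :
    2 * ∑ u, (G.adjMatrix ℝ ^ 2) w u + ((G.missedDarts w).card : ℝ) =
      (G.adjMatrix ℝ ^ 2).trace := by
  have h1 : ∑ u, (G.adjMatrix ℝ ^ 2) w u =
      ∑ x, ∑ y, G.adjMatrix ℝ w x * G.adjMatrix ℝ x y := by
    simp only [pow_two, Matrix.mul_apply]
    exact Finset.sum_comm
  have h2 : ∑ u, (G.adjMatrix ℝ ^ 2) w u =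
      ∑ x, ∑ y, G.adjMatrix ℝ w y * G.adjMatrix ℝ x y := by
    rw [h1, Finset.sum_comm]
    refine Finset.sum_congr rfl fun x _ => Finset.sum_congr rfl fun y _ => ?_
    simp [adjMatrix_apply, G.adj_comm x y]
  have h3 : ((G.missedDarts w).card : ℝ) =
      ∑ x, ∑ y, if G.Adj x y ∧ ¬ G.Adj w x ∧ ¬ G.Adj w y then 1 else 0 := by
    rw [missedDarts, Finset.card_filter, Fintype.sum_prod_type]
    push_cast
    rfl
  rw [two_mul, h3, trace_adjMatrix_sq]
  nth_rw 1 [h1]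
  rw [h2, ← Finset.sum_add_distrib, ← Finset.sum_add_distrib]
  refine Finset.sum_congr rfl fun x _ => ?_
  rw [← Finset.sum_add_distrib, ← Finset.sum_add_distrib]
  refine Finset.sum_congr rfl fun y _ => ?_
  simp only [adjMatrix_apply]
  by_cases hxy : G.Adj x y <;> by_cases hx : G.Adj w x <;> by_cases hy : G.Adj w y <;>
    simp [hxy, hx, hy]
  exact htri hx hxy hy.symm

theorem SimpleGraph.exists_missedDarts (hbip : ¬ G.IsBipartite)
    (htri : ∀ {x y z}, G.Adj x y → G.Adj y z → ¬ G.Adj z x) (w : V) :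
    ∃ p : V × V, {p, p.swap} ⊆ G.missedDarts w ∧ ({p, p.swap} : Finset (V × V)).card = 2 := by
  obtain ⟨y, z, hyz, hwyz⟩ := exists_adj_of_not_isBipartite hbip (G.neighborSet w)
  simp only [mem_neighborSet] at hwyz
  have hwy : ¬ G.Adj w y := fun h => htri h hyz (hwyz.1 h).symm
  have hwz : ¬ G.Adj w z := fun h => hwy (hwyz.2 h)
  refine ⟨(y, z), ?_, Finset.card_pair fun h => hyz.ne (Prod.ext_iff.1 h).1⟩
  intro q hq
  simp only [Finset.mem_insert, Finset.mem_singleton, Prod.swap_prod_mk] at hq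
  rcases hq with rfl | rfl <;> simp [missedDarts, hyz, hyz.symm, hwy, hwz]

theorem SimpleGraph.two_le_card_missedDarts (hbip : ¬ G.IsBipartite)
    (htri : ∀ {x y z}, G.Adj x y → G.Adj y z → ¬ G.Adj z x) (w : V) :
    2 ≤ (G.missedDarts w).card := by
  obtain ⟨p, hp, hcard⟩ := exists_missedDarts hbip htri w
  exact hcard ▸ Finset.card_le_card hp

variable (G) in
/-- The set `S` of vertices where an eigenvector for `λ₁` is largest in absolute value: row sums of
`A²` on `S` are at least `λ₁²`, and where equality holds, `S` contains all ends of walks of length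
two. -/
theorem SimpleGraph.exists_set_lambdaOne_sq_le_row_sum [Nonempty V] :
    ∃ S : Set V, S.Nonempty ∧ ∀ w ∈ S, G.lambdaOne ^ 2 ≤ ∑ u, (G.adjMatrix ℝ ^ 2) w u ∧
      (∑ u, (G.adjMatrix ℝ ^ 2) w u ≤ G.lambdaOne ^ 2 →
        ∀ y z, G.Adj w y → G.Adj y z → z ∈ S) := by
  obtain ⟨i, hi⟩ := G.exists_eigenvalues_eq_lambdaOne
  obtain ⟨v, hv0, hv⟩ := G.exists_eigenvector i
  rw [hi] at hv
  have hv2 : G.adjMatrix ℝ ^ 2 *ᵥ v = G.lambdaOne ^ 2 • v := by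
    rw [pow_two, ← mulVec_mulVec, hv, mulVec_smul, hv, smul_smul, pow_two]
  obtain ⟨w₀, hw₀⟩ := Finite.exists_max fun x => |v x|
  refine ⟨{w | ∀ x, |v x| ≤ |v w|}, ⟨w₀, hw₀⟩, fun w hw => ?_⟩
  have hpos : 0 < |v w| := by
    obtain ⟨x, hx⟩ := Function.ne_iff.1 hv0
    exact (abs_pos.2 hx).trans_le (hw x)
  have hterm : ∀ u, (G.adjMatrix ℝ ^ 2) w u * |v u| ≤ (G.adjMatrix ℝ ^ 2) w u * |v w| :=
    fun u => mul_le_mul_of_nonneg_left (hw u) (adjMatrix_pow_nonneg 2 w u)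
  have hle : G.lambdaOne ^ 2 * |v w| ≤ ∑ u, (G.adjMatrix ℝ ^ 2) w u * |v u| := by
    have h := congrFun hv2 w
    rw [Pi.smul_apply, smul_eq_mul] at h
    rw [← abs_of_nonneg (sq_nonneg G.lambdaOne), ← abs_mul, ← h]
    refine (Finset.abs_sum_le_sum_abs _ _).trans (Finset.sum_le_sum fun u _ => ?_)
    rw [abs_mul, abs_of_nonneg (adjMatrix_pow_nonneg 2 w u)]
  refine ⟨?_, fun heq y z hwy hyz => ?_⟩
  · have h := hle.trans (Finset.sum_le_sum fun u _ => hterm u)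
    rw [← Finset.sum_mul] at h
    exact le_of_mul_le_mul_right h hpos
  · have hA : 0 < (G.adjMatrix ℝ ^ 2) w z := by
      rw [pow_two, Matrix.mul_apply]
      refine Finset.sum_pos' (fun x _ => ?_) ⟨y, Finset.mem_univ y, by simp [hwy, hyz]⟩
      simp only [adjMatrix_apply]
      split_ifs <;> simp
    have hz : |v w| ≤ |v z| := by
      by_contra! hlt
      have h : ∑ u, (G.adjMatrix ℝ ^ 2) w u * |v u| < ∑ u, (G.adjMatrix ℝ ^ 2) w u * |v w| :=
        Finset.sum_lt_sum (fun u _ => hterm u) ⟨z, Finset.mem_univ z, mul_lt_mul_of_pos_left hlt hA⟩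
      rw [← Finset.sum_mul] at h
      have := mul_le_mul_of_nonneg_right heq hpos.le
      linarith
    exact fun x => (hw x).trans hz

theorem SimpleGraph.lambdaOne_sq_le (hbip : ¬ G.IsBipartite)
    (htri : ∀ {x y z}, G.Adj x y → G.Adj y z → ¬ G.Adj z x) :
    G.lambdaOne ^ 2 ≤ (G.adjMatrix ℝ ^ 2).trace / 2 - 1 := by
  obtain ⟨x, -⟩ := exists_adj_of_not_isBipartite hbip ∅
  have : Nonempty V := ⟨x⟩
  obtain ⟨S, ⟨w, hw⟩, hS⟩ := G.exists_set_lambdaOne_sq_le_row_sum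
  have h1 := (hS w hw).1
  have h2 := two_mul_row_sum_add_card_missedDarts htri w
  have h3 : (2 : ℝ) ≤ (G.missedDarts w).card := by
    exact_mod_cast two_le_card_missedDarts hbip htri w
  linarith

theorem SimpleGraph.isC5WithIsolated_of_lambdaOne_sq_eq (hbip : ¬ G.IsBipartite)
    (htri : ∀ {x y z}, G.Adj x y → G.Adj y z → ¬ G.Adj z x)
    (heq : G.lambdaOne ^ 2 = (G.adjMatrix ℝ ^ 2).trace / 2 - 1) : G.IsC5WithIsolated := by
  obtain ⟨x, -⟩ := exists_adj_of_not_isBipartite hbip ∅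
  have : Nonempty V := ⟨x⟩
  obtain ⟨S, ⟨w, hw⟩, hS⟩ := G.exists_set_lambdaOne_sq_le_row_sum
  refine isC5WithIsolated_of_closed hbip htri S hw (fun w y z hw hwy hyz => ?_) fun w hw => ?_
  · have h2 := two_mul_row_sum_add_card_missedDarts htri w
    have h3 : (2 : ℝ) ≤ (G.missedDarts w).card := by
      exact_mod_cast two_le_card_missedDarts hbip htri w
    exact (hS w hw).2 (by linarith) y z hwy hyz
  · have hcard : (G.missedDarts w).card ≤ 2 := by
      have h1 := (hS w hw).1
      have h2 := two_mul_row_sum_add_card_missedDarts htri w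
      have h3 : ((G.missedDarts w).card : ℝ) ≤ 2 := by linarith
      exact_mod_cast h3
    obtain ⟨p, hp, hp2⟩ := exists_missedDarts hbip htri w
    have hE := Finset.eq_of_subset_of_card_le hp (hp2 ▸ hcard)
    have hmem : ∀ x y, G.Adj x y → ¬ G.Adj w x → ¬ G.Adj w y → (x, y) = p ∨ (x, y) = p.swap := by
      intro x y hxy hx hy
      have : (x, y) ∈ G.missedDarts w := by simp [missedDarts, hxy, hx, hy]
      rw [← hE] at this
      simpa only [Finset.mem_insert, Finset.mem_singleton] using this
    intro x y x' y' hxy hx hy hxy' hx' hy'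
    obtain ⟨p1, p2⟩ := p
    have h1 := hmem x y hxy hx hy
    have h2 := hmem x' y' hxy' hx' hy'
    simp only [Prod.swap_prod_mk, Prod.mk.injEq] at h1 h2
    rcases h1 with ⟨rfl, rfl⟩ | ⟨rfl, rfl⟩ <;> rcases h2 with ⟨rfl, rfl⟩ | ⟨rfl, rfl⟩ <;> simp

theorem SimpleGraph.IsC5WithIsolated.trace_le (h : G.IsC5WithIsolated) :
    (G.adjMatrix ℝ ^ 2).trace / 2 - 1 ≤ G.lambdaOne ^ 2 := by
  classical
  obtain ⟨m, ⟨e⟩⟩ := h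
  have hadj : ∀ x y, G.adjMatrix ℝ x y =
      if (cycleGraph 5 ⊕g (⊥ : SimpleGraph (Fin m))).Adj (e x) (e y) then 1 else 0 := by
    intro x y
    rw [adjMatrix_apply]
    exact if_congr e.map_rel_iff.symm rfl rfl
  have hsum (F : Fin 5 ⊕ Fin m → Fin 5 ⊕ Fin m → ℝ) :
      ∑ x, ∑ y, F (e x) (e y) = ∑ p, ∑ q, F p q := by
    rw [← Equiv.sum_comp e.toEquiv]
    exact Finset.sum_congr rfl fun x _ => Equiv.sum_comp e.toEquiv (F (e x))
  have h10 : ∑ i : Fin 5, ∑ j : Fin 5, (if (cycleGraph 5).Adj i j then (1 : ℝ) else 0) = 10 := by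
    have : ∑ i : Fin 5, ∑ j : Fin 5, (if (cycleGraph 5).Adj i j then 1 else 0) = 10 := by decide
    exact_mod_cast this
  have htr : (G.adjMatrix ℝ ^ 2).trace = 10 := by
    rw [trace_adjMatrix_sq]
    simp only [hadj]
    rw [hsum fun p q => if (cycleGraph 5 ⊕g (⊥ : SimpleGraph (Fin m))).Adj p q then 1 else 0]
    simp only [Fintype.sum_sum_type, sum_adj_inl, sum_adj_inr, not_adj_sum_inl_inr,
      (cycleGraph 5 ⊕g (⊥ : SimpleGraph (Fin m))).adj_comm (Sum.inr _) (Sum.inl _), bot_adj,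
      if_false, Finset.sum_const_zero, add_zero]
    convert h10
  let z : V → ℝ := fun x => Sum.elim (fun _ => 1) (fun _ => 0) (e x)
  have hzz : z ⬝ᵥ z = 5 := by
    have h := Equiv.sum_comp e.toEquiv (fun p => (Sum.elim (fun _ => (1 : ℝ)) (fun _ => 0) p) *
      (Sum.elim (fun _ => (1 : ℝ)) (fun _ => 0) p))
    refine h.trans ?_
    simp [Fintype.sum_sum_type]
  have hzAz : z ⬝ᵥ G.adjMatrix ℝ *ᵥ z = 10 := by
    simp only [dotProduct, mulVec, Finset.mul_sum, hadj, z]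
    rw [hsum fun p q => Sum.elim (fun _ => (1 : ℝ)) (fun _ => 0) p *
      ((if (cycleGraph 5 ⊕g (⊥ : SimpleGraph (Fin m))).Adj p q then 1 else 0) *
        Sum.elim (fun _ => (1 : ℝ)) (fun _ => 0) q)]
    simp only [Fintype.sum_sum_type, sum_adj_inl, Sum.elim_inl, Sum.elim_inr, mul_zero, zero_mul,
      one_mul, mul_one, Finset.sum_const_zero, add_zero]
    convert h10
  have h2 : 2 ≤ G.lambdaOne := by
    have := G.dotProduct_adjMatrix_mulVec_le z
    rw [hzz, hzAz] at this
    linarith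
  rw [htr]
  nlinarith

end TriangleFreeSpectral

theorem mainTheorem2 {V : Type*} [Fintype V] [DecidableEq V] (G : SimpleGraph V)
    [DecidableRel G.Adj] (k : ℕ) (hk : 1 ≤ k) (hbip : ¬ G.IsBipartite)
    (hfree : G.ShortOddCycleFree k) :
    G.lambdaOne ^ (2 * k) ≤
        ((G.adjMatrix ℝ) ^ (2 * k)).trace / 2 - (2 * Real.cos (Real.pi / (k + 2))) ^ (2 * k) ∧
      (G.lambdaOne ^ (2 * k) =
          ((G.adjMatrix ℝ) ^ (2 * k)).trace / 2 - (2 * Real.cos (Real.pi / (k + 2))) ^ (2 * k) ↔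
        k = 1 ∧ G.IsC5WithIsolated) := by
  rcases hk.eq_or_lt with rfl | hk2
  · have hcos : (2 * Real.cos (Real.pi / ((1 : ℕ) + 2))) ^ (2 * 1) = 1 := by
      have : Real.pi / ((1 : ℕ) + 2) = Real.pi / 3 := by norm_num
      rw [this, Real.cos_pi_div_three]
      norm_num
    have htri : ∀ {x y z}, G.Adj x y → G.Adj y z → ¬ G.Adj z x :=
      fun {_ _ _} => SimpleGraph.not_adj_of_shortOddCycleFree_one hfree hbip
    rw [hcos, mul_one]
    have hle := SimpleGraph.lambdaOne_sq_le hbip htri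
    exact ⟨hle, fun heq => ⟨rfl, SimpleGraph.isC5WithIsolated_of_lambdaOne_sq_eq hbip htri heq⟩,
      fun h => le_antisymm hle h.2.trace_le⟩
  · have hlt := SimpleGraph.pow_lambdaOne_lt hk2 hbip hfree
    exact ⟨by linarith, fun heq => by linarith, fun h => by omega⟩
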